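/- Let $\sigma_1=\begin{pmatrix}0&1\\1&0\end{pmatrix}$, $\sigma_2=\begin{pmatrix}0&-i\\i&0\end{pmatrix}$, $\sigma_3=\begin{pmatrix}1&0\\0&-1\end{pmatrix}$ be the Pauli matrices and $\alpha_j=\begin{pmatrix}0&\sigma_j\\\sigma_j&0\end{pmatrix}$ ($j=1,2,3$) the $4\times4$ Dirac matrices. Let $Q=(q_{jk})$ be a function on $\mathbb R^3$ whose values $Q(x)$ are $4\times4$ Hermitian matrices, with measurable entries such that, for some constants $\rho>1$ and $C>0$, $|q_{jk}(x)|\le C(1+|x|^2)^{-\rho/2}$ for all $x\in\mathbb R^3$ and all $j,k$. Let $H=\sum_{j=1}^3\alpha_j\frac1i\partial_j+Q$ be the massless Dirac operator in $[L^2(\mathbb R^3)]^4$ with domain the Sobolev space $[H^1(\mathbb R^3)]^4$. Let $f$ be a zero mode of $H$, that is, $f\in[H^1(\mathbb R^3)]^4$ and $Hf=0$. Then $Qf$ is integrable on $\mathbb R^3$, and $f$ has a (unique) continuous representative, again denoted by $f$, for which the following holds, $|\cdot|$ being the Euclidean norm on $\mathbb C^4$ on both sides. For every $\omega$ in the unit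 sphere $\mathbb S^2$, $$\lim_{r\to+\infty}r^2|f(r\omega)|=\frac1{4\pi}\Big|\int_{\mathbb R^3}Q(y)f(y)\,dy\Big| ;$$ in particular the limit does not depend on $\omega$. Moreover, the following three conditions are equivalent: (a) $\lim_{r\to+\infty}r^2f(r\omega)=0$ for some $\omega\in\mathbb S^2$; (b) $\lim_{r\to+\infty}r^2f(r\omega)=0$ for every $\omega\in\mathbb S^2$; (c) $\int_{\mathbb R^3}Q(y)f(y)\,dy=0$. -/

import Mathlib

open MeasureTheory Filter Topology

namespace DiracZeroMode

open scoped ContDiff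

/-- Euclidean three-space. -/
abbrev R3 : Type := EuclideanSpace ℝ (Fin 3)

/-- Four-component spinors, with the Hermitian norm of `ℂ⁴`. -/
abbrev Spinor : Type := EuclideanSpace ℂ (Fin 4)

/-- The Pauli matrices `σ₁, σ₂, σ₃`. -/
def pauli : Fin 3 → Matrix (Fin 2) (Fin 2) ℂ :=
  ![!![0, 1; 1, 0], !![0, -Complex.I; Complex.I, 0], !![1, 0; 0, -1]]

/-- The Dirac matrices `α₁, α₂, α₃`: two-by-two blocks with zero diagonal blocks and
off-diagonal blocks `σⱼ`. -/
def alpha (j : Fin 3) : Matrix (Fin 4) (Fin 4) ℂ :=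
  Matrix.reindex finSumFinEquiv finSumFinEquiv (Matrix.fromBlocks 0 (pauli j) (pauli j) 0)

/-- A matrix-valued potential whose entries are Lebesgue measurable and bounded by
`C ⟨x⟩ ^ (-ρ)` with `ρ > 1`, `⟨x⟩ = √(1 + |x|²)`, and whose values are Hermitian. -/
structure IsAdmissiblePotential (Q : R3 → Matrix (Fin 4) (Fin 4) ℂ) : Prop where
  aemeasurable : ∀ j k, AEMeasurable (fun x => Q x j k) volume
  decay : ∃ ρ C : ℝ, 1 < ρ ∧ 0 < C ∧
    ∀ x j k, ‖Q x j k‖ ≤ C * (Real.sqrt (1 + ‖x‖ ^ 2)) ^ (-ρ)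
  hermitian : ∀ x, (Q x).IsHermitian

/-- `g` is the weak partial derivative `∂ⱼ f` on all of `ℝ³`, for functions that are integrable
on compact sets. -/
def HasWeakPartialDeriv (j : Fin 3) (f g : R3 → Spinor) : Prop :=
  ∀ φ : R3 → ℝ, ContDiff ℝ ∞ φ → HasCompactSupport φ →
    ∫ x, (fderiv ℝ φ x (EuclideanSpace.single j 1)) • f x = -∫ x, φ x • g x

/-- `f` belongs to the Sobolev space `[H¹(ℝ³)]⁴`, with weak gradient `df`. -/
structure IsSobolevOneWithGradient (f : R3 → Spinor) (df : Fin 3 → R3 → Spinor) : Prop where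
  memLp : MemLp f 2 volume
  memLp_grad : ∀ j, MemLp (df j) 2 volume
  weakDeriv : ∀ j, HasWeakPartialDeriv j f (df j)

/-- The pointwise expression `(α · D) f + Q f`, with `D = (1 / i) ∇` and `df` for `∇ f`. -/
noncomputable def diracExpr (Q : R3 → Matrix (Fin 4) (Fin 4) ℂ) (f : R3 → Spinor)
    (df : Fin 3 → R3 → Spinor) (x : R3) : Spinor :=
  (∑ j, Matrix.toEuclideanLin (alpha j) (Complex.I⁻¹ • df j x)) +
    Matrix.toEuclideanLin (Q x) (f x)

/-- The graph of the Dirac operator `H = α · D + Q` with domain `[H¹(ℝ³)]⁴`: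
`f` is in the domain and `H f = h` almost everywhere. -/
def DiracGraph (Q : R3 → Matrix (Fin 4) (Fin 4) ℂ) (f h : R3 → Spinor) : Prop :=
  ∃ df : Fin 3 → R3 → Spinor, IsSobolevOneWithGradient f df ∧ diracExpr Q f df =ᵐ[volume] h

/-- A zero mode: an element `f` of the domain of `H` such that `H f = 0`. -/
def IsZeroMode (Q : R3 → Matrix (Fin 4) (Fin 4) ℂ) (f : R3 → Spinor) : Prop :=
  DiracGraph Q f 0

/-- The function `Q f`. -/
noncomputable def potentialMul (Q : R3 → Matrix (Fin 4) (Fin 4) ℂ) (f : R3 → Spinor) (y : R3) :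
    Spinor :=
  Matrix.toEuclideanLin (Q y) (f y)

end DiracZeroMode

/-! ### Riesz potentials of power weights -/

namespace DiracZeroMode

open scoped ENNReal NNReal

/-! Write `F = Q f`. Inverting the free Dirac operator by its fundamental solution gives, for almost
every `x`, `4π f(x) = i ∫ α·(y - x) / |y - x|³ F(y) dy` (`ae_eq_integral_diracKernel`); everything
is read off from this formula.

Since `|α·v s| = |v| |s|` (`norm_alphaDot`), the formula makes `u = |f|` a subsolution: `u ≤ c ∫ |x
- y|⁻² (1 + |y|)^(-ρ) u(y) dy`. Iterating this turns square integrability into boundedness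
(`exists_ae_le_const_of_le_lintegral_rieszKernel`). Each further iteration then gains a fixed power
of decay because `ρ > 1`, until the decay `|x|⁻²` of the kernel itself is reached
(`exists_ae_le_decayWeight_two`). Hence `F` is `O(|y|^(-3-δ))` with `δ = ρ - 1`, so it is
integrable.

With this decay the potential is defined and continuous everywhere, which gives the continuous
representative. The kernel is homogeneous of degree `-2`, so `r²` times the potential at `rω` tends
to `-α·ω ∫ F` (`tendsto_sq_smul_diracPotential`). As `α·ω` is an isometry for unit `ω`, the norm of
the limit does not see `ω`, and the limit vanishes in one direction exactly when `∫ F = 0`.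

The representation is proved by testing the weak equation with `α` applied to the Coulomb field
`z/|z|³`, cut off smoothly near the origin and near infinity. The relation `(α·v)² = |v|²` turns the
left side into the divergence of the field times `f`: a mass `4π` concentrating at `x`, minus the
same mass spread out towards infinity, which a square integrable function does not feel. -/

/-- The Riesz kernel `|x - y| ^ (-a)`, with values in `[0, ∞]`. -/
noncomputable def rieszKernel (a : ℝ) (x y : R3) : ℝ≥0∞ := ENNReal.ofReal (‖x - y‖ ^ (-a))

/-- The weight `(1 + |x|) ^ (-b)`, with values in `[0, ∞]`. -/
noncomputable def decayWeight (b : ℝ) (x : R3) : ℝ≥0∞ := ENNReal.ofReal ((1 + ‖x‖) ^ (-b))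

lemma measurable_rieszKernel (a : ℝ) : Measurable fun p : R3 × R3 => rieszKernel a p.1 p.2 := by
  unfold rieszKernel; fun_prop

lemma measurable_rieszKernel_left (a : ℝ) (x : R3) : Measurable fun y => rieszKernel a x y := by
  unfold rieszKernel; fun_prop

lemma measurable_decayWeight (b : ℝ) : Measurable (decayWeight b) := by
  unfold decayWeight; fun_prop

lemma rieszKernel_comm (a : ℝ) (x y : R3) : rieszKernel a x y = rieszKernel a y x := by
  rw [rieszKernel, rieszKernel, norm_sub_rev]

lemma rieszKernel_mul_rieszKernel {a b : ℝ} (ha : 0 < a) (hb : 0 < b) (x y : R3) :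
    rieszKernel a x y * rieszKernel b x y = rieszKernel (a + b) x y := by
  rw [rieszKernel, rieszKernel, rieszKernel, ← ENNReal.ofReal_mul (by positivity)]
  congr 1
  rcases (norm_nonneg (x - y)).eq_or_lt with h | h
  -- On the diagonal the kernel has the default value `0 ^ (-a) = 0`, not `∞`. This holds only for
  -- nonzero exponents, hence the positivity assumptions.
  · rw [← h, Real.zero_rpow (by linarith), Real.zero_rpow (by linarith),
      Real.zero_rpow (by linarith), zero_mul]
  · rw [← Real.rpow_add h, neg_add]

lemma decayWeight_mul_decayWeight (a b : ℝ) (x : R3) :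
    decayWeight a x * decayWeight b x = decayWeight (a + b) x := by
  have : 0 < 1 + ‖x‖ := by positivity
  rw [decayWeight, decayWeight, decayWeight, ← ENNReal.ofReal_mul (by positivity),
    ← Real.rpow_add this, neg_add]

lemma decayWeight_ne_top (b : ℝ) (x : R3) : decayWeight b x ≠ ∞ := ENNReal.ofReal_ne_top

lemma decayWeight_pos (b : ℝ) (x : R3) : 0 < decayWeight b x :=
  ENNReal.ofReal_pos.2 (by positivity)

lemma decayWeight_anti {a b : ℝ} (h : a ≤ b) (x : R3) : decayWeight b x ≤ decayWeight a x :=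
  ENNReal.ofReal_le_ofReal
    (Real.rpow_le_rpow_of_exponent_le (by linarith [norm_nonneg x]) (by linarith))

@[simp] lemma decayWeight_zero (x : R3) : decayWeight 0 x = 1 := by simp [decayWeight]

lemma decayWeight_le_one {b : ℝ} (hb : 0 ≤ b) (x : R3) : decayWeight b x ≤ 1 :=
  (decayWeight_anti hb x).trans_eq (decayWeight_zero x)

/-- The integral of the Riesz kernel over a ball. -/
lemma lintegral_ball_rieszKernel {a r : ℝ} (ha : a < 3) (hr : 0 < r) (x : R3) :
    ∫⁻ y in Metric.ball x r, rieszKernel a x y =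
      ENNReal.ofReal (4 * Real.pi / (3 - a) * r ^ (3 - a)) := by
  set h : ℝ → ℝ := (Set.Iio r).indicator fun t => t ^ (-a) with hh
  have hcongr : Set.EqOn (fun t : ℝ => t ^ 2 • h t)
      ((Set.Ioo 0 r).indicator fun t => t ^ (2 - a)) (Set.Ioi 0) := by
    intro t ht
    have ht' : 0 < t := ht
    by_cases htr : t < r
    · simp only [hh, Set.indicator, Set.mem_Iio, htr, if_true, Set.mem_Ioo, ht', and_self,
        smul_eq_mul]
      rw [← Real.rpow_natCast, ← Real.rpow_add ht']
      norm_num; rfl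
    · simp [hh, htr]
  have hioo : IntegrableOn (fun t : ℝ => t ^ (2 - a)) (Set.Ioo 0 r) :=
    (intervalIntegral.integrableOn_Ioo_rpow_iff hr).2 (by linarith)
  have hInt : IntegrableOn (fun t : ℝ => t ^ 2 • h t) (Set.Ioi 0) := by
    rw [integrableOn_congr_fun hcongr measurableSet_Ioi,
      integrableOn_indicator_iff measurableSet_Ioo]
    exact hioo.mono_set Set.inter_subset_left
  have hI : Integrable (fun z : R3 => h ‖z‖) := by
    rw [integrable_fun_norm_addHaar volume (f := h)]
    simpa using hInt
  have hval : ∫ z : R3, h ‖z‖ = 4 * Real.pi / (3 - a) * r ^ (3 - a) := by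
    rw [integral_fun_norm_addHaar volume h]
    simp only [finrank_euclideanSpace, Fintype.card_fin, Nat.add_one_sub_one]
    rw [setIntegral_congr_fun measurableSet_Ioi hcongr, setIntegral_indicator measurableSet_Ioo,
      Set.inter_eq_right.2 Set.Ioo_subset_Ioi_self, ← integral_Ioc_eq_integral_Ioo,
      ← intervalIntegral.integral_of_le hr.le, integral_rpow (Or.inl (by linarith)),
      Real.zero_rpow (by linarith), Measure.real, EuclideanSpace.volume_ball_fin_three]
    rw [show 2 - a + 1 = 3 - a by ring]
    have : 3 - a ≠ 0 := by linarith
    have := Real.pi_pos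
    simp [ENNReal.toReal_ofReal (show 0 ≤ Real.pi * 4 / 3 by positivity)]
    field_simp
  have hnn : ∀ t, 0 ≤ t → 0 ≤ h t := fun t ht =>
    Set.indicator_apply_nonneg fun _ => Real.rpow_nonneg ht _
  rw [← hval, ofReal_integral_eq_lintegral_ofReal hI (ae_of_all _ fun z => hnn _ (norm_nonneg _)),
    ← lintegral_sub_left_eq_self (fun z : R3 => ENNReal.ofReal (h ‖z‖)) x,
    ← lintegral_indicator measurableSet_ball]
  refine lintegral_congr fun y => ?_
  by_cases hy : y ∈ Metric.ball x r
  · have hy' : ‖x - y‖ < r := by rwa [Metric.mem_ball', dist_eq_norm] at hy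
    simp [hy, hh, rieszKernel, hy']
  · have hy' : ¬ ‖x - y‖ < r := by rwa [Metric.mem_ball', dist_eq_norm] at hy
    simp [hy, hh, hy']

/-- Decay of the Riesz potential of a power weight. -/
lemma exists_lintegral_rieszKernel_mul_decayWeight_le {a b t : ℝ} (ht : 0 ≤ t) (hta : t ≤ a)
    (ha : a < 3) (habt : 3 < a + b - t) :
    ∃ C : ℝ≥0, ∀ x, ∫⁻ y, rieszKernel a x y * decayWeight b y ≤ C * decayWeight t x := by
  set D : ℝ≥0∞ := ∫⁻ y : R3, decayWeight (a + b - t) y with hD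
  have hDfin : D < ∞ := finite_integral_one_add_norm (by simpa using habt)
  set c₁ : ℝ := 2 ^ b * (4 * Real.pi / (3 - a)) with hc₁
  have h3a : 0 < 3 - a := by linarith
  have hc₁' : 0 ≤ c₁ := by have := Real.pi_pos; positivity
  refine ⟨c₁.toNNReal + (3 ^ a : ℝ).toNNReal * D.toNNReal, fun x => ?_⟩
  -- Inside this ball `1 + |y| ≥ r`, so the weight is comparable to its value at `x`. Outside it,
  -- `|x - y|` controls both `1 + |x|` and `1 + |y|`.
  set r : ℝ := (1 + ‖x‖) / 2 with hr
  have hx1 : 0 < 1 + ‖x‖ := by positivity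
  have hr0 : 0 < r := by positivity
  rw [← lintegral_add_compl _ (measurableSet_ball (x := x) (ε := r))]
  have near : ∫⁻ y in Metric.ball x r, rieszKernel a x y * decayWeight b y ≤
      ENNReal.ofReal c₁ * decayWeight t x := by
    calc ∫⁻ y in Metric.ball x r, rieszKernel a x y * decayWeight b y
        ≤ ∫⁻ y in Metric.ball x r, rieszKernel a x y * ENNReal.ofReal (r ^ (-b)) := by
          refine setLIntegral_mono' measurableSet_ball fun y hy => ?_
          gcongr
          have hy' : ‖x - y‖ < r := by rwa [Metric.mem_ball', dist_eq_norm] at hy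
          refine ENNReal.ofReal_le_ofReal (Real.rpow_le_rpow_of_nonpos hr0 ?_ (by linarith))
          linarith [norm_sub_norm_le x y]
      _ = ENNReal.ofReal (4 * Real.pi / (3 - a) * r ^ (3 - a) * r ^ (-b)) := by
          rw [lintegral_mul_const _ (measurable_rieszKernel_left a x),
            lintegral_ball_rieszKernel ha hr0, ← ENNReal.ofReal_mul
            (by have := Real.pi_pos; positivity)]
      _ ≤ _ := by
          rw [decayWeight, ← ENNReal.ofReal_mul hc₁']
          refine ENNReal.ofReal_le_ofReal ?_
          have e1 : r ^ (3 - a) ≤ (1 + ‖x‖) ^ (3 - a) :=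
            Real.rpow_le_rpow hr0.le (by rw [hr]; linarith) h3a.le
          have e2 : r ^ (-b) = 2 ^ b * (1 + ‖x‖) ^ (-b) := by
            rw [hr, Real.div_rpow hx1.le zero_le_two, Real.rpow_neg zero_le_two, div_inv_eq_mul,
              mul_comm]
          have e3 : (1 + ‖x‖) ^ (3 - a) * (1 + ‖x‖) ^ (-b) ≤ (1 + ‖x‖) ^ (-t) := by
            rw [← Real.rpow_add hx1]
            exact Real.rpow_le_rpow_of_exponent_le (by linarith [norm_nonneg x]) (by linarith)
          have hp : 0 ≤ 4 * Real.pi / (3 - a) := by have := Real.pi_pos; positivity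
          calc 4 * Real.pi / (3 - a) * r ^ (3 - a) * r ^ (-b)
              ≤ 4 * Real.pi / (3 - a) * (1 + ‖x‖) ^ (3 - a) * (2 ^ b * (1 + ‖x‖) ^ (-b)) := by
                rw [e2]; gcongr
            _ = c₁ * ((1 + ‖x‖) ^ (3 - a) * (1 + ‖x‖) ^ (-b)) := by rw [hc₁]; ring
            _ ≤ _ := by gcongr
  -- Of the `a` powers of `|x - y|`, `t` are spent on decay in `x` and `a - t` on decay in `y`; the
  -- remaining weight has exponent `a + b - t > 3`, so it is integrable.
  have far : ∫⁻ y in (Metric.ball x r)ᶜ, rieszKernel a x y * decayWeight b y ≤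
      ENNReal.ofReal (3 ^ a) * D * decayWeight t x := by
    calc ∫⁻ y in (Metric.ball x r)ᶜ, rieszKernel a x y * decayWeight b y
        ≤ ∫⁻ y in (Metric.ball x r)ᶜ,
            ENNReal.ofReal (3 ^ a) * decayWeight t x * decayWeight (a + b - t) y := by
          refine setLIntegral_mono' measurableSet_ball.compl fun y hy => ?_
          have hy' : r ≤ ‖x - y‖ := by
            rw [Set.mem_compl_iff, Metric.mem_ball', dist_eq_norm] at hy; linarith
          have hy1 : 0 < 1 + ‖y‖ := by positivity
          have hz : 0 < ‖x - y‖ := hr0.trans_le hy'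
          have k1 : (1 + ‖x‖) / 3 ≤ ‖x - y‖ := by rw [hr] at hy'; linarith
          have k2 : (1 + ‖y‖) / 3 ≤ ‖x - y‖ := by
            have := norm_sub_norm_le y x
            rw [norm_sub_rev] at this
            rw [hr] at hy'; linarith
          rw [show a + b - t = (a - t) + b by ring, ← decayWeight_mul_decayWeight, ← mul_assoc]
          gcongr
          rw [rieszKernel, decayWeight, decayWeight, ← ENNReal.ofReal_mul (by positivity),
            ← ENNReal.ofReal_mul (by positivity)]
          refine ENNReal.ofReal_le_ofReal ?_
          calc ‖x - y‖ ^ (-a) = ‖x - y‖ ^ (-t) * ‖x - y‖ ^ (-(a - t)) := by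
                rw [← Real.rpow_add hz]; congr 1; ring
            _ ≤ ((1 + ‖x‖) / 3) ^ (-t) * ((1 + ‖y‖) / 3) ^ (-(a - t)) := by
                gcongr ?_ * ?_
                · exact Real.rpow_le_rpow_of_nonpos (by positivity) k1 (by linarith)
                · exact Real.rpow_le_rpow_of_nonpos (by positivity) k2 (by linarith)
            _ = 3 ^ a * (1 + ‖x‖) ^ (-t) * (1 + ‖y‖) ^ (-(a - t)) := by
                rw [Real.div_rpow hx1.le (by norm_num), Real.div_rpow hy1.le (by norm_num),
                  Real.rpow_neg (x := 3) (by norm_num) t,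
                  Real.rpow_neg (x := 3) (by norm_num) (a - t), div_inv_eq_mul, div_inv_eq_mul,
                  show (3 : ℝ) ^ a = 3 ^ t * 3 ^ (a - t) by
                    rw [← Real.rpow_add (by norm_num)]; congr 1; ring]
                ring
      _ ≤ ∫⁻ y, ENNReal.ofReal (3 ^ a) * decayWeight t x * decayWeight (a + b - t) y :=
          setLIntegral_le_lintegral _ _
      _ = _ := by
          rw [lintegral_const_mul _ (measurable_decayWeight _), mul_assoc, mul_assoc,
            mul_comm D]
  refine (add_le_add near far).trans_eq ?_
  rw [← add_mul]
  push_cast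
  rw [ENNReal.coe_toNNReal hDfin.ne]
  rfl

/-- The Cauchy–Schwarz inequality for nonnegative functions. -/
lemma sq_lintegral_mul_le {α : Type*} [MeasurableSpace α] {μ : Measure α} {f g : α → ℝ≥0∞}
    (hf : AEMeasurable f μ) (hg : AEMeasurable g μ) :
    (∫⁻ a, f a * g a ∂μ) ^ 2 ≤ (∫⁻ a, f a ^ 2 ∂μ) * ∫⁻ a, g a ^ 2 ∂μ := by
  have h := ENNReal.lintegral_mul_le_Lp_mul_Lq μ Real.HolderConjugate.two_two hf hg
  simp only [Pi.mul_apply, ENNReal.rpow_two] at h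
  calc _ ≤ ((∫⁻ a, f a ^ 2 ∂μ) ^ (1 / 2 : ℝ) * (∫⁻ a, g a ^ 2 ∂μ) ^ (1 / 2 : ℝ)) ^ 2 := by gcongr
    _ = _ := by
      rw [mul_pow, ← ENNReal.rpow_natCast, ← ENNReal.rpow_natCast, ← ENNReal.rpow_mul,
        ← ENNReal.rpow_mul]
      norm_num

end DiracZeroMode

/-! ### Bootstrapping: from square integrability to quadratic decay -/

namespace DiracZeroMode

open scoped ENNReal NNReal

/-- Cauchy–Schwarz after splitting `2 = 4/3 + 2/3`. The exponent `8/3` is still below `3`, so the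
first factor is bounded in `x`. The kernel left over, of exponent `4/3`, is locally square
integrable, which is what the iteration needs. -/
lemma sq_lintegral_rieszKernel_two_le (ρ : ℝ) {u : R3 → ℝ≥0∞} (hu : AEMeasurable u) (x : R3) :
    (∫⁻ y, rieszKernel 2 x y * (decayWeight ρ y * u y)) ^ 2 ≤
      (∫⁻ y, rieszKernel (8 / 3) x y * decayWeight ρ y) *
        ∫⁻ y, rieszKernel (4 / 3) x y * (decayWeight ρ y * u y ^ 2) := by
  have hW (y : R3) : decayWeight ρ y = decayWeight (ρ / 2) y * decayWeight (ρ / 2) y := by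
    rw [decayWeight_mul_decayWeight, add_halves]
  have hm (a : ℝ) : AEMeasurable fun y => rieszKernel a x y :=
    (measurable_rieszKernel_left a x).aemeasurable
  have hw := (measurable_decayWeight (ρ / 2)).aemeasurable (μ := volume)
  convert sq_lintegral_mul_le ((hm (4 / 3)).mul hw) ((hm (2 / 3)).mul (hw.mul hu)) using 1
  · congr 1
    refine lintegral_congr fun y => ?_
    have h2 := rieszKernel_mul_rieszKernel (a := 4 / 3) (b := 2 / 3) (by norm_num) (by norm_num) x y
    norm_num at h2
    rw [hW, ← h2]
    simp only [Pi.mul_apply]; ring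
  · congr 1
    · refine lintegral_congr fun y => ?_
      rw [hW, show (8 / 3 : ℝ) = 4 / 3 + 4 / 3 by norm_num,
        ← rieszKernel_mul_rieszKernel (by norm_num) (by norm_num)]
      simp only [Pi.mul_apply]; ring
    · refine lintegral_congr fun y => ?_
      rw [hW, show (4 / 3 : ℝ) = 2 / 3 + 2 / 3 by norm_num,
        ← rieszKernel_mul_rieszKernel (by norm_num) (by norm_num)]
      simp only [Pi.mul_apply]; ring

lemma aemeasurable_rieszKernel_mul (a : ℝ) {v : R3 → ℝ≥0∞} (hv : AEMeasurable v) :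
    AEMeasurable (fun p : R3 × R3 => rieszKernel a p.1 p.2 * v p.2) (volume.prod volume) :=
  (measurable_rieszKernel a).aemeasurable.mul hv.comp_snd

lemma lintegral_rieszKernel_two_lt_top {ρ : ℝ} (hρ : 1 < ρ) {u : R3 → ℝ≥0∞}
    (hu : AEMeasurable u) (h2 : ∫⁻ x, u x ^ 2 < ∞) :
    ∀ᵐ x, ∫⁻ y, rieszKernel 2 x y * (decayWeight ρ y * u y) < ∞ := by
  obtain ⟨M, hM⟩ := exists_lintegral_rieszKernel_mul_decayWeight_le (a := 8 / 3) (b := ρ) (t := 0)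
    le_rfl (by norm_num) (by norm_num) (by linarith)
  obtain ⟨N, hN⟩ := exists_lintegral_rieszKernel_mul_decayWeight_le (a := 4 / 3) (b := 2) (t := 0)
    le_rfl (by norm_num) (by norm_num) (by norm_num)
  set v : R3 → ℝ≥0∞ := fun y => decayWeight ρ y * u y ^ 2 with hv
  have hvm : AEMeasurable v := (measurable_decayWeight ρ).aemeasurable.mul (hu.pow_const 2)
  have hvu (y : R3) : v y ≤ u y ^ 2 := mul_le_of_le_one_left' (decayWeight_le_one (by linarith) y)
  have hjm := aemeasurable_rieszKernel_mul (4 / 3) hvm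
  -- For `ρ` near `1` the decay `4/3 + ρ` can fall short of `3`, so finiteness is obtained only
  -- almost everywhere, by integrating against an auxiliary weight with `4/3 + 2 > 3` and applying
  -- Tonelli.
  have key : ∫⁻ x, decayWeight 2 x * ∫⁻ y, rieszKernel (4 / 3) x y * v y < ∞ := by
    calc ∫⁻ x, decayWeight 2 x * ∫⁻ y, rieszKernel (4 / 3) x y * v y
        = ∫⁻ x, ∫⁻ y, decayWeight 2 x * (rieszKernel (4 / 3) x y * v y) := by
          refine lintegral_congr fun x => ?_
          rw [lintegral_const_mul' _ _ (decayWeight_ne_top 2 x)]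
      _ = ∫⁻ y, ∫⁻ x, decayWeight 2 x * (rieszKernel (4 / 3) x y * v y) :=
          lintegral_lintegral_swap
            (((measurable_decayWeight 2).comp measurable_fst).aemeasurable.mul hjm)
      _ = ∫⁻ y, (∫⁻ x, rieszKernel (4 / 3) y x * decayWeight 2 x) * v y := by
          refine lintegral_congr fun y => ?_
          refine Eq.trans ?_ (lintegral_mul_const _
            ((measurable_rieszKernel_left _ y).mul (measurable_decayWeight 2)))
          refine lintegral_congr fun x => ?_
          rw [rieszKernel_comm]; ring
      _ ≤ ∫⁻ y, N * u y ^ 2 := by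
          refine lintegral_mono fun y => ?_
          gcongr
          · simpa using hN y
          · exact hvu y
      _ = N * ∫⁻ y, u y ^ 2 := lintegral_const_mul' _ _ ENNReal.coe_ne_top
      _ < ∞ := ENNReal.mul_lt_top ENNReal.coe_lt_top h2
  have hmeas : AEMeasurable fun x => decayWeight 2 x * ∫⁻ y, rieszKernel (4 / 3) x y * v y :=
    (measurable_decayWeight 2).aemeasurable.mul hjm.lintegral_prod_right'
  filter_upwards [ae_lt_top' hmeas key.ne] with x hx
  have hfin : ∫⁻ y, rieszKernel (4 / 3) x y * v y < ∞ := by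
    by_contra hcon
    rw [not_lt_top_iff] at hcon
    rw [hcon, ENNReal.mul_top (decayWeight_pos 2 x).ne'] at hx
    exact lt_irrefl _ hx
  have := sq_lintegral_rieszKernel_two_le ρ hu x
  have hlt : (∫⁻ y, rieszKernel 2 x y * (decayWeight ρ y * u y)) ^ 2 < ∞ :=
    this.trans_lt (ENNReal.mul_lt_top
      ((hM x).trans_lt (ENNReal.mul_lt_top ENNReal.coe_lt_top (decayWeight_ne_top 0 x).lt_top))
      hfin)
  exact (ENNReal.pow_lt_top_iff.1 hlt).resolve_right (by norm_num)

/-- A square integrable function dominated by its own weighted Riesz potential is bounded. -/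
lemma exists_ae_le_const_of_le_lintegral_rieszKernel {ρ : ℝ} (hρ : 1 < ρ) {u : R3 → ℝ≥0∞}
    (hu : AEMeasurable u) (h2 : ∫⁻ x, u x ^ 2 < ∞) {c : ℝ≥0}
    (h : ∀ᵐ x, u x ≤ c * ∫⁻ y, rieszKernel 2 x y * (decayWeight ρ y * u y)) :
    ∃ C : ℝ≥0, ∀ᵐ x, u x ≤ C := by
  obtain ⟨M, hM⟩ := exists_lintegral_rieszKernel_mul_decayWeight_le (a := 8 / 3) (b := ρ) (t := 0)
    le_rfl (by norm_num) (by norm_num) (by linarith)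
  simp only [decayWeight_zero, mul_one] at hM
  set U : R3 → ℝ≥0∞ := fun x => u x ^ 2 with hU
  have hUm : AEMeasurable U := hu.pow_const 2
  have hWm := (measurable_decayWeight ρ)
  set T : (R3 → ℝ≥0∞) → R3 → ℝ≥0∞ :=
    fun v x => ∫⁻ y, rieszKernel (4 / 3) x y * (decayWeight ρ y * v y) with hT
  have h1 : ∀ᵐ x, U x ≤ ((c ^ 2 * M : ℝ≥0) : ℝ≥0∞) * T U x := by
    filter_upwards [h] with x hx
    calc U x ≤ (c * ∫⁻ y, rieszKernel 2 x y * (decayWeight ρ y * u y)) ^ 2 := by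
          simp only [hU]; gcongr
      _ ≤ c ^ 2 * (M * T U x) := by
          rw [mul_pow]
          gcongr
          refine (sq_lintegral_rieszKernel_two_le ρ hu x).trans ?_
          gcongr
          exact hM x
      _ = _ := by push_cast; ring
  -- `T` is positive, so the almost everywhere inequality for `U = u²` can be iterated once: `U` is
  -- bounded by a multiple of `T (T U)`.
  have h3 (x : R3) : T U x ≤ ((c ^ 2 * M : ℝ≥0) : ℝ≥0∞) * T (T U) x := by
    rw [hT]
    simp only
    rw [← lintegral_const_mul' _ _ ENNReal.coe_ne_top]
    refine lintegral_mono_ae ?_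
    filter_upwards [h1] with y hy
    calc _ ≤ rieszKernel (4 / 3) x y *
          (decayWeight ρ y * (((c ^ 2 * M : ℝ≥0) : ℝ≥0∞) * T U y)) := by
          gcongr
      _ = _ := by ring
  -- The kernel of `T ∘ T` is bounded: Cauchy–Schwarz in the intermediate variable leaves two
  -- integrals with exponent `8/3`. So `T ∘ T` maps integrable functions to bounded ones.
  have h4 (x : R3) : T (T U) x ≤ M * ∫⁻ z, U z := by
    have hjm := aemeasurable_rieszKernel_mul (4 / 3) (hWm.aemeasurable.mul hUm)
    calc T (T U) x
        = ∫⁻ y, ∫⁻ z, rieszKernel (4 / 3) x y * decayWeight ρ y *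
            (rieszKernel (4 / 3) y z * (decayWeight ρ z * U z)) := by
          refine lintegral_congr fun y => ?_
          rw [← mul_assoc]
          exact (lintegral_const_mul' _ _
            (ENNReal.mul_ne_top ENNReal.ofReal_ne_top (decayWeight_ne_top ρ y))).symm
      _ = ∫⁻ z, ∫⁻ y, rieszKernel (4 / 3) x y * decayWeight ρ y *
            (rieszKernel (4 / 3) y z * (decayWeight ρ z * U z)) :=
          lintegral_lintegral_swap
            ((((measurable_rieszKernel_left _ x).mul hWm).comp
              measurable_fst).aemeasurable.mul hjm)
      _ ≤ ∫⁻ z, M * U z := by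
          refine lintegral_mono_ae ?_
          filter_upwards [] with z
          have hW (y : R3) : decayWeight ρ y = decayWeight (ρ / 2) y * decayWeight (ρ / 2) y := by
            rw [decayWeight_mul_decayWeight, add_halves]
          have hm (w : R3) : Measurable fun y => rieszKernel (4 / 3) w y * decayWeight (ρ / 2) y :=
            (measurable_rieszKernel_left _ w).mul (measurable_decayWeight _)
          have hsq (w : R3) : ∫⁻ y, (rieszKernel (4 / 3) w y * decayWeight (ρ / 2) y) ^ 2 ≤ M := by
            refine le_trans (le_of_eq (lintegral_congr fun y => ?_)) (hM w)
            rw [hW, show (8 / 3 : ℝ) = 4 / 3 + 4 / 3 by norm_num,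
              ← rieszKernel_mul_rieszKernel (by norm_num) (by norm_num)]
            ring
          have hcs := sq_lintegral_mul_le (hm x).aemeasurable (hm z).aemeasurable (μ := volume)
          have hle : ∫⁻ y, rieszKernel (4 / 3) x y * decayWeight (ρ / 2) y *
              (rieszKernel (4 / 3) z y * decayWeight (ρ / 2) y) ≤ M := by
            rw [← ENNReal.pow_le_pow_left_iff two_ne_zero]
            refine hcs.trans ?_
            rw [sq]
            exact mul_le_mul' (hsq x) (hsq z)
          calc _ = ∫⁻ y, rieszKernel (4 / 3) x y * decayWeight (ρ / 2) y *
              (rieszKernel (4 / 3) z y * decayWeight (ρ / 2) y) * (decayWeight ρ z * U z) := by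
                refine lintegral_congr fun y => ?_
                rw [rieszKernel_comm _ z y, hW y]; ring
            _ = (∫⁻ y, rieszKernel (4 / 3) x y * decayWeight (ρ / 2) y *
              (rieszKernel (4 / 3) z y * decayWeight (ρ / 2) y)) * (decayWeight ρ z * U z) :=
                lintegral_mul_const _ ((hm x).mul (hm z))
            _ ≤ M * U z := by
                gcongr
                exact mul_le_of_le_one_left' (decayWeight_le_one (by linarith) z)
      _ = M * ∫⁻ z, U z := lintegral_const_mul' _ _ ENNReal.coe_ne_top
  set B : ℝ≥0∞ := ((c ^ 2 * M : ℝ≥0) : ℝ≥0∞) * (((c ^ 2 * M : ℝ≥0) : ℝ≥0∞) * (M * ∫⁻ z, U z))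
    with hB
  have hBfin : B ≠ ∞ := by
    refine ENNReal.mul_ne_top ENNReal.coe_ne_top (ENNReal.mul_ne_top ENNReal.coe_ne_top
      (ENNReal.mul_ne_top ENNReal.coe_ne_top h2.ne))
  refine ⟨B.toNNReal + 1, ?_⟩
  filter_upwards [h1] with x hx
  have hUB : u x ^ 2 ≤ B := hx.trans (by
    rw [hB]; gcongr; exact (h3 x).trans (by gcongr; exact h4 x))
  push_cast
  rw [ENNReal.coe_toNNReal hBfin]
  rcases le_total (u x) 1 with h' | h'
  · exact h'.trans le_add_self
  · calc u x = u x * 1 := (mul_one _).symm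
      _ ≤ u x * u x := by gcongr
      _ ≤ B := by rwa [← sq]
      _ ≤ B + 1 := le_self_add

/-- A square integrable function dominated by its own weighted Riesz potential decays like
`|x| ^ (-2)`. -/
lemma exists_ae_le_decayWeight_two {ρ : ℝ} (hρ : 1 < ρ) {u : R3 → ℝ≥0∞}
    (hu : AEMeasurable u) (h2 : ∫⁻ x, u x ^ 2 < ∞) {c : ℝ≥0}
    (h : ∀ᵐ x, u x ≤ c * ∫⁻ y, rieszKernel 2 x y * (decayWeight ρ y * u y)) :
    ∃ C : ℝ≥0, ∀ᵐ x, u x ≤ C * decayWeight 2 x := by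
  -- A gain of `δ` per step needs `δ < ρ - 1`. Taking `δ = 2/n` with `2δ ≤ ρ - 1` leaves strict room
  -- and makes the `n`-th step land exactly on exponent `2`, the largest the kernel permits.
  obtain ⟨n, hn⟩ := exists_nat_gt (4 / (ρ - 1))
  have hρ' : 0 < ρ - 1 := by linarith
  have hn0 : (0 : ℝ) < n := lt_trans (by positivity) hn
  set δ : ℝ := 2 / n with hδ
  have hδ0 : 0 < δ := by positivity
  have hδρ : 2 * δ ≤ ρ - 1 := by
    rw [div_lt_iff₀ hρ'] at hn
    rw [hδ, ← mul_div_assoc, div_le_iff₀ hn0]; linarith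
  have hnδ : n * δ = 2 := by rw [hδ]; field_simp
  have step : ∀ k : ℕ, k ≤ n → ∃ C : ℝ≥0, ∀ᵐ x, u x ≤ C * decayWeight (k * δ) x := by
    intro k
    induction k with
    | zero =>
      intro _
      simpa using exists_ae_le_const_of_le_lintegral_rieszKernel hρ hu h2 h
    | succ k ih =>
      intro hk
      obtain ⟨C, hC⟩ := ih (by omega)
      have hk' : ((k : ℝ) + 1) * δ ≤ 2 := by
        rw [← hnδ]; gcongr; exact_mod_cast hk
      have hkδ : 0 ≤ k * δ := by positivity
      obtain ⟨D, hD⟩ := exists_lintegral_rieszKernel_mul_decayWeight_le (a := 2) (b := ρ + k * δ)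
        (t := (k + 1) * δ) (by positivity) hk' (by norm_num) (by linarith)
      refine ⟨c * (C * D), ?_⟩
      filter_upwards [h] with x hx
      refine hx.trans ?_
      push_cast
      rw [mul_assoc, mul_assoc]
      gcongr
      calc ∫⁻ y, rieszKernel 2 x y * (decayWeight ρ y * u y)
          ≤ ∫⁻ y, C * (rieszKernel 2 x y * decayWeight (ρ + k * δ) y) := by
            refine lintegral_mono_ae ?_
            filter_upwards [hC] with y hy
            calc _ ≤ rieszKernel 2 x y * (decayWeight ρ y * (C * decayWeight (k * δ) y)) := by
                  gcongr
              _ = _ := by rw [← decayWeight_mul_decayWeight]; ring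
        _ = C * ∫⁻ y, rieszKernel 2 x y * decayWeight (ρ + k * δ) y :=
            lintegral_const_mul' _ _ ENNReal.coe_ne_top
        _ ≤ _ := by gcongr; exact hD x
  simpa [hnδ] using step n le_rfl

end DiracZeroMode

/-! ### Clifford algebra of the Dirac matrices -/

namespace DiracZeroMode

open scoped ContDiff

/-- The matrix `α · v = ∑ₖ vₖ αₖ` acting on spinors, real linear in both arguments. -/
noncomputable def alphaDot : R3 →L[ℝ] Spinor →L[ℝ] Spinor :=
  ∑ k, (EuclideanSpace.proj k : R3 →L[ℝ] ℝ).smulRight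
    ((LinearMap.toContinuousLinearMap (Matrix.toEuclideanLin (alpha k))).restrictScalars ℝ)

lemma alphaDot_apply (v : R3) (s : Spinor) :
    alphaDot v s = ∑ k, v k • Matrix.toEuclideanLin (alpha k) s := by
  simp [alphaDot]

lemma alphaDot_apply_coord (v : R3) (s : Spinor) :
    alphaDot v s = !₂[v 2 * s 2 + (v 0 - v 1 * Complex.I) * s 3,
      (v 0 + v 1 * Complex.I) * s 2 - v 2 * s 3, v 2 * s 0 + (v 0 - v 1 * Complex.I) * s 1,
      (v 0 + v 1 * Complex.I) * s 0 - v 2 * s 1] := by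
  rw [alphaDot_apply]
  ext i
  have e (k : Fin 3) (i j : Fin 4) : alpha k i j =
      Matrix.fromBlocks 0 (pauli k) (pauli k) 0 (finSumFinEquiv.symm i)
        (finSumFinEquiv.symm j) := rfl
  have e0 : (finSumFinEquiv.symm (0 : Fin 4) : Fin 2 ⊕ Fin 2) = Sum.inl 0 := rfl
  have e1 : (finSumFinEquiv.symm (1 : Fin 4) : Fin 2 ⊕ Fin 2) = Sum.inl 1 := rfl
  have e2 : (finSumFinEquiv.symm (2 : Fin 4) : Fin 2 ⊕ Fin 2) = Sum.inr 0 := rfl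
  have e3 : (finSumFinEquiv.symm (3 : Fin 4) : Fin 2 ⊕ Fin 2) = Sum.inr 1 := rfl
  fin_cases i <;>
  · simp [Fin.sum_univ_three, Matrix.toLpLin_apply, Matrix.mulVec, dotProduct, Fin.sum_univ_four,
      e, e0, e1, e2, e3, pauli]
    ring

/-- The source of the independence of `ω` in the theorem, and of the exact size `|x - y|⁻²` of the
Dirac kernel. -/
lemma norm_alphaDot (v : R3) (s : Spinor) : ‖alphaDot v s‖ = ‖v‖ * ‖s‖ := by
  rw [← sq_eq_sq₀ (norm_nonneg _) (by positivity), mul_pow, EuclideanSpace.norm_sq_eq,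
    EuclideanSpace.norm_sq_eq, EuclideanSpace.norm_sq_eq, alphaDot_apply_coord]
  simp [Fin.sum_univ_three, Fin.sum_univ_four, Complex.sq_norm, Complex.normSq_apply]
  ring

lemma alphaDot_alphaDot (v : R3) (s : Spinor) : alphaDot v (alphaDot v s) = ‖v‖ ^ 2 • s := by
  rw [EuclideanSpace.real_norm_sq_eq, alphaDot_apply_coord, alphaDot_apply_coord]
  ext i
  fin_cases i <;>
  · simp [Fin.sum_univ_three]
    ring_nf
    simp [Complex.I_sq]

lemma toEuclideanLin_alpha (k : Fin 3) (s : Spinor) :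
    Matrix.toEuclideanLin (alpha k) s = alphaDot (EuclideanSpace.single k 1) s := by
  rw [alphaDot_apply]
  simp [ite_smul]

lemma alphaDot_smul_complex (v : R3) (c : ℂ) (s : Spinor) :
    alphaDot v (c • s) = c • alphaDot v s := by
  rw [alphaDot_apply, alphaDot_apply, Finset.smul_sum]
  exact Finset.sum_congr rfl fun k _ => by rw [map_smul, smul_comm]

/-! ### The weak equation tested against radial fields -/

/-- The test function `(y - x)ₖ g (|y - x|²)`. -/
noncomputable def radialTest (g : ℝ → ℝ) (x : R3) (k : Fin 3) (y : R3) : ℝ :=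
  (y - x) k * g (‖y - x‖ ^ 2)

lemma contDiff_radialTest {g : ℝ → ℝ} (hg : ContDiff ℝ ∞ g) (x : R3) (k : Fin 3) :
    ContDiff ℝ ∞ (radialTest g x k) := by
  have h1 : ContDiff ℝ ∞ fun y : R3 => (y - x) k :=
    (EuclideanSpace.proj k : R3 →L[ℝ] ℝ).contDiff.comp (contDiff_id.sub contDiff_const)
  exact h1.mul (hg.comp ((contDiff_id.sub contDiff_const).norm_sq ℝ))

lemma hasCompactSupport_radialTest {g : ℝ → ℝ} {R : ℝ} (hR : ∀ s, R ^ 2 ≤ s → g s = 0) (x : R3)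
    (k : Fin 3) : HasCompactSupport (radialTest g x k) := by
  refine HasCompactSupport.of_support_subset_isCompact (isCompact_closedBall x |R|) fun y hy => ?_
  by_contra hcon
  refine hy ?_
  rw [Metric.mem_closedBall, dist_eq_norm, not_le] at hcon
  rw [radialTest, hR _ (by rw [← sq_abs R]; gcongr), mul_zero]

lemma fderiv_radialTest {g : ℝ → ℝ} (hg : Differentiable ℝ g) (x : R3) (j k : Fin 3) (y : R3) :
    fderiv ℝ (radialTest g x k) y (EuclideanSpace.single j 1) =
      2 * deriv g (‖y - x‖ ^ 2) * (y - x) j * (y - x) k +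
        (if j = k then 1 else 0) * g (‖y - x‖ ^ 2) := by
  have h1 : HasFDerivAt (fun y : R3 => (y - x) k) (EuclideanSpace.proj k : R3 →L[ℝ] ℝ) y :=
    ((EuclideanSpace.proj k : R3 →L[ℝ] ℝ).hasFDerivAt.comp y ((hasFDerivAt_id y).sub_const x))
  have h2 : HasFDerivAt (fun y : R3 => ‖y - x‖ ^ 2) (2 • innerSL ℝ (y - x)) y := by
    simpa using ((hasFDerivAt_id y).sub_const x).norm_sq
  have h3 := h1.mul ((hg _).hasDerivAt.comp_hasFDerivAt y h2)
  have h4 : fderiv ℝ (radialTest g x k) y = _ := h3.fderiv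
  rw [h4]
  simp [EuclideanSpace.inner_single_right, eq_comm]
  ring

lemma alphaDot_eq_sum (v : R3) (s : Spinor) :
    alphaDot v s = ∑ k, v k • alphaDot (EuclideanSpace.single k 1) s := by
  simp only [← toEuclideanLin_alpha]
  exact alphaDot_apply v s

lemma sum_alphaDot_of_diracExpr_eq_zero {Q : R3 → Matrix (Fin 4) (Fin 4) ℂ} {f : R3 → Spinor}
    {df : Fin 3 → R3 → Spinor} {y : R3} (h : diracExpr Q f df y = 0) :
    ∑ j, alphaDot (EuclideanSpace.single j 1) (df j y) = -(Complex.I • potentialMul Q f y) := by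
  have h1 : Complex.I⁻¹ • ∑ j, alphaDot (EuclideanSpace.single j 1) (df j y) =
      -potentialMul Q f y := by
    rw [eq_neg_iff_add_eq_zero, ← h, diracExpr, Finset.smul_sum]
    simp only [map_smul, toEuclideanLin_alpha]
    rfl
  rw [← smul_neg, ← h1, smul_smul, mul_inv_cancel₀ Complex.I_ne_zero, one_smul]

/-- The weak Dirac equation tested against the radial fields `(y - x) g (|y - x|²)`. -/
lemma integral_radial_smul_eq {Q : R3 → Matrix (Fin 4) (Fin 4) ℂ} {f : R3 → Spinor}
    {df : Fin 3 → R3 → Spinor} (hs : IsSobolevOneWithGradient f df)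
    (hd : diracExpr Q f df =ᵐ[volume] 0) {g : ℝ → ℝ} (hg : ContDiff ℝ ∞ g) {R : ℝ}
    (hR : ∀ s, R ^ 2 ≤ s → g s = 0) (x : R3) :
    ∫ y, (2 * ‖y - x‖ ^ 2 * deriv g (‖y - x‖ ^ 2) + 3 * g (‖y - x‖ ^ 2)) • f y =
      Complex.I • ∫ y, g (‖y - x‖ ^ 2) • alphaDot (y - x) (potentialMul Q f y) := by
  set e : Fin 3 → R3 := fun k => EuclideanSpace.single k 1 with he
  set A : Fin 3 → Fin 3 → Spinor →L[ℝ] Spinor := fun k j => alphaDot (e k) ∘L alphaDot (e j) with hA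
  have hφ := contDiff_radialTest hg x
  have hφc := hasCompactSupport_radialTest hR x
  have hint1 (k j : Fin 3) : Integrable fun y => fderiv ℝ (radialTest g x k) y (e j) • f y :=
    (hs.memLp.locallyIntegrable (by norm_num)).integrable_smul_left_of_hasCompactSupport
      (((hφ k).continuous_fderiv (by simp)).clm_apply continuous_const)
      ((hφc k).fderiv_apply ℝ (e j))
  have hint2 (k j : Fin 3) : Integrable fun y => radialTest g x k y • df j y :=
    ((hs.memLp_grad j).locallyIntegrable (by norm_num)).integrable_smul_left_of_hasCompactSupport
      (hφ k).continuous (hφc k)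
  -- The weak derivative identity for the `k`-th component of the field is multiplied by `αₖ αⱼ` and
  -- summed, so that `∑ αⱼ ∂ⱼ f` appears on the right.
  have hmain : ∑ k, ∑ j, A k j (∫ y, fderiv ℝ (radialTest g x k) y (e j) • f y) =
      -∑ k, ∑ j, A k j (∫ y, radialTest g x k y • df j y) := by
    simp only [← Finset.sum_neg_distrib, ← map_neg]
    exact Finset.sum_congr rfl fun k _ => Finset.sum_congr rfl fun j _ => by
      rw [hs.weakDeriv j _ (hφ k) (hφc k)]
  have hL : ∑ k, ∑ j, A k j (∫ y, fderiv ℝ (radialTest g x k) y (e j) • f y) =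
      ∫ y, ∑ k, ∑ j, A k j (fderiv ℝ (radialTest g x k) y (e j) • f y) := by
    rw [integral_finsetSum _ fun k _ => integrable_finsetSum _ fun j _ =>
      (A k j).integrable_comp (hint1 k j)]
    refine Finset.sum_congr rfl fun k _ => ?_
    rw [integral_finsetSum _ fun j _ => (A k j).integrable_comp (hint1 k j)]
    exact Finset.sum_congr rfl fun j _ => ((A k j).integral_comp_comm (hint1 k j)).symm
  have hRt : ∑ k, ∑ j, A k j (∫ y, radialTest g x k y • df j y) =
      ∫ y, ∑ k, ∑ j, A k j (radialTest g x k y • df j y) := by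
    rw [integral_finsetSum _ fun k _ => integrable_finsetSum _ fun j _ =>
      (A k j).integrable_comp (hint2 k j)]
    refine Finset.sum_congr rfl fun k _ => ?_
    rw [integral_finsetSum _ fun j _ => (A k j).integrable_comp (hint2 k j)]
    exact Finset.sum_congr rfl fun j _ => ((A k j).integral_comp_comm (hint2 k j)).symm
  -- The part of the derivative falling on `g` gives `(α·(y - x))² = |y - x|²`; the Kronecker delta
  -- gives `∑ αₖ² = 3`.
  have hLpt (y : R3) : ∑ k, ∑ j, A k j (fderiv ℝ (radialTest g x k) y (e j) • f y) =
      (2 * ‖y - x‖ ^ 2 * deriv g (‖y - x‖ ^ 2) + 3 * g (‖y - x‖ ^ 2)) • f y := by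
    have h1 : ∑ k, ∑ j, ((y - x) j * (y - x) k) • alphaDot (e k) (alphaDot (e j) (f y)) =
        ‖y - x‖ ^ 2 • f y := by
      rw [← alphaDot_alphaDot, alphaDot_eq_sum (y - x) (alphaDot (y - x) (f y))]
      refine Finset.sum_congr rfl fun k _ => ?_
      rw [alphaDot_eq_sum (y - x) (f y), map_sum, Finset.smul_sum]
      refine Finset.sum_congr rfl fun j _ => ?_
      rw [map_smul, smul_smul, mul_comm]
    have h2 (k : Fin 3) : alphaDot (e k) (alphaDot (e k) (f y)) = f y := by
      rw [alphaDot_alphaDot]; simp [he]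
    calc _ = ∑ k, (∑ j, (2 * deriv g (‖y - x‖ ^ 2)) •
          ((y - x) j * (y - x) k) • alphaDot (e k) (alphaDot (e j) (f y)) +
          g (‖y - x‖ ^ 2) • alphaDot (e k) (alphaDot (e k) (f y))) := by
          refine Finset.sum_congr rfl fun k _ => ?_
          simp only [he, fderiv_radialTest (hg.differentiable (by simp)), hA, map_smul, add_smul,
            map_add, Finset.sum_add_distrib, ContinuousLinearMap.comp_apply]
          congr 1
          · refine Finset.sum_congr rfl fun j _ => ?_
            rw [smul_smul]; congr 1; ring
          · simp [ite_smul]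
      _ = _ := by
          simp only [h2, Finset.sum_add_distrib, ← Finset.smul_sum, h1]
          rw [Finset.sum_const, Finset.card_univ, Fintype.card_fin, smul_smul,
            ← Nat.cast_smul_eq_nsmul ℝ, smul_smul, ← add_smul]
          congr 1; push_cast; ring
  have hRpt : ∀ᵐ y, ∑ k, ∑ j, A k j (radialTest g x k y • df j y) =
      -(Complex.I • g (‖y - x‖ ^ 2) • alphaDot (y - x) (potentialMul Q f y)) := by
    filter_upwards [hd] with y hy
    have h1 := sum_alphaDot_of_diracExpr_eq_zero hy
    calc _ = ∑ k, g (‖y - x‖ ^ 2) • (y - x) k •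
          alphaDot (e k) (∑ j, alphaDot (e j) (df j y)) := by
          refine Finset.sum_congr rfl fun k _ => ?_
          rw [map_sum, Finset.smul_sum, Finset.smul_sum]
          refine Finset.sum_congr rfl fun j _ => ?_
          rw [map_smul, smul_smul, mul_comm]; rfl
      _ = _ := by
          rw [← Finset.smul_sum, ← alphaDot_eq_sum, h1, map_neg, alphaDot_smul_complex, smul_neg,
            smul_comm]
  rw [hL, hRt] at hmain
  simp only [hLpt] at hmain
  rw [hmain, integral_congr_ae hRpt, integral_neg, neg_neg, integral_smul]

end DiracZeroMode

/-! ### The smoothly truncated Coulomb field and its divergence -/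

namespace DiracZeroMode

open scoped ContDiff

/-- A smooth step: `0` on `(-∞, 1]` and `1` on `[2, ∞)`. -/
noncomputable def smoothStep (s : ℝ) : ℝ := Real.smoothTransition (s - 1)

lemma smoothStep_of_le_one {s : ℝ} (h : s ≤ 1) : smoothStep s = 0 :=
  Real.smoothTransition.zero_of_nonpos (by linarith)

lemma smoothStep_of_two_le {s : ℝ} (h : 2 ≤ s) : smoothStep s = 1 :=
  Real.smoothTransition.one_of_one_le (by linarith)

lemma smoothStep_nonneg (s : ℝ) : 0 ≤ smoothStep s := Real.smoothTransition.nonneg _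

lemma smoothStep_le_one (s : ℝ) : smoothStep s ≤ 1 := Real.smoothTransition.le_one _

lemma contDiff_smoothStep : ContDiff ℝ ∞ smoothStep :=
  Real.smoothTransition.contDiff.comp (contDiff_id.sub contDiff_const)

lemma monotone_smoothStep : Monotone smoothStep := fun _ _ h =>
  Real.smoothTransition.monotone (by linarith)

lemma differentiable_smoothStep : Differentiable ℝ smoothStep :=
  contDiff_smoothStep.differentiable (by simp)

lemma continuous_deriv_smoothStep : Continuous (deriv smoothStep) :=
  contDiff_smoothStep.continuous_deriv (by simp)

lemma deriv_smoothStep_nonneg (s : ℝ) : 0 ≤ deriv smoothStep s := monotone_smoothStep.deriv_nonneg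

lemma deriv_smoothStep_of_lt_one {s : ℝ} (h : s < 1) : deriv smoothStep s = 0 := by
  have : smoothStep =ᶠ[𝓝 s] fun _ => 0 := by
    filter_upwards [Iio_mem_nhds h] with t ht using smoothStep_of_le_one (le_of_lt ht)
  rw [this.deriv_eq, deriv_const]

lemma deriv_smoothStep_of_two_lt {s : ℝ} (h : 2 < s) : deriv smoothStep s = 0 := by
  have : smoothStep =ᶠ[𝓝 s] fun _ => 1 := by
    filter_upwards [Ioi_mem_nhds h] with t ht using smoothStep_of_two_le (le_of_lt ht)
  rw [this.deriv_eq, deriv_const]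

lemma exists_deriv_smoothStep_le : ∃ B : ℝ, 0 ≤ B ∧ ∀ s, deriv smoothStep s ≤ B := by
  obtain ⟨B, hB⟩ := (isCompact_Icc (a := (1 : ℝ)) (b := 2)).exists_bound_of_continuousOn
    continuous_deriv_smoothStep.continuousOn
  have hB0 : 0 ≤ B := (norm_nonneg _).trans (hB 1 (by norm_num))
  refine ⟨B, hB0, fun s => ?_⟩
  by_cases h1 : s < 1
  · rw [deriv_smoothStep_of_lt_one h1]; exact hB0
  by_cases h2 : 2 < s
  · rw [deriv_smoothStep_of_two_lt h2]; exact hB0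
  exact (le_abs_self _).trans (hB s ⟨by linarith, by linarith⟩)

/-- The profile `s ^ (-3/2)`, cut off smoothly for `s ≤ q ^ (-2)`. -/
noncomputable def cutoffProfile (q s : ℝ) : ℝ := s ^ (-(3 / 2) : ℝ) * smoothStep (q ^ 2 * s)

/-- The function `2 s G' + 3 G` for the profile `G = cutoffProfile q`; as a function of `|z|²` it
is the divergence of the field `G (|z|²) z`. -/
noncomputable def cutoffDensity (q s : ℝ) : ℝ :=
  2 * s ^ (-(1 / 2) : ℝ) * (q ^ 2 * deriv smoothStep (q ^ 2 * s))

lemma cutoffProfile_eventuallyEq_zero {q s : ℝ} (h : q ^ 2 * s < 1) :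
    cutoffProfile q =ᶠ[𝓝 s] fun _ => 0 := by
  have : ∀ᶠ t in 𝓝 s, q ^ 2 * t < 1 :=
    (continuous_const.mul continuous_id).continuousAt.eventually_lt_const h
  filter_upwards [this] with t ht
  rw [cutoffProfile, smoothStep_of_le_one ht.le, mul_zero]

lemma pos_of_one_le_sq_mul {q s : ℝ} (h : ¬ q ^ 2 * s < 1) : 0 < s := by
  by_contra hs
  nlinarith [sq_nonneg q]

lemma contDiff_cutoffProfile (q : ℝ) : ContDiff ℝ ∞ (cutoffProfile q) := by
  rw [contDiff_iff_contDiffAt]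
  intro s
  by_cases h : q ^ 2 * s < 1
  · exact contDiffAt_const.congr_of_eventuallyEq (cutoffProfile_eventuallyEq_zero h)
  · exact (Real.contDiffAt_rpow_const_of_ne (pos_of_one_le_sq_mul h).ne').mul
      (contDiff_smoothStep.comp (contDiff_const.mul contDiff_id)).contDiffAt

/-- The power `s ^ (-3/2)` solves `2 s G' + 3 G = 0`: the Coulomb field is divergence free off the
origin. Only the derivative of the cutoff survives. -/
lemma two_mul_deriv_cutoffProfile_add (q s : ℝ) :
    2 * s * deriv (cutoffProfile q) s + 3 * cutoffProfile q s = cutoffDensity q s := by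
  by_cases h : q ^ 2 * s < 1
  · rw [(cutoffProfile_eventuallyEq_zero h).deriv_eq,
      (cutoffProfile_eventuallyEq_zero h).eq_of_nhds,
      cutoffDensity, deriv_smoothStep_of_lt_one h]
    simp
  · have hs := pos_of_one_le_sq_mul h
    have h1 : HasDerivAt (fun t : ℝ => t ^ (-(3 / 2) : ℝ)) _ s :=
      Real.hasDerivAt_rpow_const (Or.inl hs.ne')
    have h2 : HasDerivAt (fun t : ℝ => smoothStep (q ^ 2 * t))
        (deriv smoothStep (q ^ 2 * s) * (q ^ 2 * 1)) s :=
      (differentiable_smoothStep _).hasDerivAt.comp s ((hasDerivAt_id s).const_mul (q ^ 2))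
    have h3 : deriv (cutoffProfile q) s = _ := (h1.mul h2).deriv
    have e1 : s * s ^ (-(3 / 2) - 1 : ℝ) = s ^ (-(3 / 2) : ℝ) := by
      nth_rewrite 1 [← Real.rpow_one s]
      rw [← Real.rpow_add hs]; norm_num
    have e2 : s * s ^ (-(3 / 2) : ℝ) = s ^ (-(1 / 2) : ℝ) := by
      nth_rewrite 1 [← Real.rpow_one s]
      rw [← Real.rpow_add hs]; norm_num
    rw [h3, cutoffProfile, cutoffDensity, ← e2]
    linear_combination (-3 * smoothStep (q ^ 2 * s)) * e1

lemma cutoffDensity_nonneg (q : ℝ) {s : ℝ} (hs : 0 ≤ s) : 0 ≤ cutoffDensity q s := by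
  have := deriv_smoothStep_nonneg (q ^ 2 * s)
  unfold cutoffDensity; positivity

lemma sq_rpow_neg_half {t : ℝ} (ht : 0 ≤ t) : (t ^ 2) ^ (-(1 / 2) : ℝ) = t⁻¹ := by
  rw [← Real.rpow_natCast, ← Real.rpow_mul ht]
  norm_num [Real.rpow_neg_one]

lemma cutoffDensity_of_lt {q t : ℝ} (hq : 0 < q) (h : 2 / q < t) : cutoffDensity q (t ^ 2) = 0 := by
  rw [div_lt_iff₀ hq] at h
  rw [cutoffDensity, deriv_smoothStep_of_two_lt (by nlinarith), mul_zero, mul_zero]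

lemma cutoffDensity_of_lt_inv {q t : ℝ} (hq : 0 < q) (ht : 0 ≤ t) (h : t < q⁻¹) :
    cutoffDensity q (t ^ 2) = 0 := by
  rw [← one_div, lt_div_iff₀' hq] at h
  have h0 : 0 ≤ q * t := by positivity
  rw [cutoffDensity, deriv_smoothStep_of_lt_one (by nlinarith), mul_zero, mul_zero]

/-- The density vanishes for `t < 1/q`, and beyond that `t⁻¹ ≤ q`: height `q³` on the length scale
`1/q`, as for an approximate identity. -/
lemma exists_cutoffDensity_le : ∃ B : ℝ, 0 ≤ B ∧ ∀ q t : ℝ, 0 < q → 0 ≤ t →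
    cutoffDensity q (t ^ 2) ≤ B * q ^ 3 := by
  obtain ⟨B, hB0, hB⟩ := exists_deriv_smoothStep_le
  refine ⟨2 * B, by positivity, fun q t hq ht => ?_⟩
  by_cases h : t < q⁻¹
  · rw [cutoffDensity_of_lt_inv hq ht h]; positivity
  · have ht' : t⁻¹ ≤ q := inv_le_of_inv_le₀ hq (not_lt.1 h)
    rw [cutoffDensity, sq_rpow_neg_half ht]
    calc 2 * t⁻¹ * (q ^ 2 * deriv smoothStep (q ^ 2 * t ^ 2)) ≤ 2 * q * (q ^ 2 * B) := by
          gcongr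
          · exact mul_nonneg (by positivity) (deriv_smoothStep_nonneg _)
          · exact hB _
      _ = _ := by ring

/-- A majorant independent of `q ≤ 1`. It is not integrable over space but square integrable, hence
suited to dominated convergence against square integrable functions. On the support `1 ≤ t ≤ 2/q`,
so `q ≤ 4/(1 + t)`. -/
lemma exists_cutoffDensity_le_one_add : ∃ B : ℝ, 0 ≤ B ∧ ∀ q t : ℝ, 0 < q → q ≤ 1 → 0 ≤ t →
    cutoffDensity q (t ^ 2) ≤ B * (1 + t) ^ (-3 : ℝ) := by
  obtain ⟨B, hB0, hB⟩ := exists_cutoffDensity_le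
  refine ⟨B * 64, by positivity, fun q t hq hq1 ht => ?_⟩
  by_cases h : t < q⁻¹
  · rw [cutoffDensity_of_lt_inv hq ht h]; positivity
  by_cases h2 : 2 / q < t
  · rw [cutoffDensity_of_lt hq h2]; positivity
  have h1t : 1 ≤ t := ((one_le_inv₀ hq).2 hq1).trans (not_lt.1 h)
  rw [not_lt, le_div_iff₀ hq] at h2
  have hqt : q ≤ 4 / (1 + t) := by
    rw [le_div_iff₀ (by positivity)]; nlinarith
  calc cutoffDensity q (t ^ 2) ≤ B * q ^ 3 := hB q t hq ht
    _ ≤ B * (4 / (1 + t)) ^ 3 := by gcongr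
    _ = _ := by
      rw [Real.rpow_neg (by positivity), div_pow]
      norm_cast
      ring

lemma measurable_cutoffDensity (q : ℝ) : Measurable (cutoffDensity q) := by
  have := continuous_deriv_smoothStep.measurable
  unfold cutoffDensity; fun_prop

/-- In polar coordinates the integrand is the exact derivative of `smoothStep (q² t²)`, which climbs
from `0` to `1`; what remains is the area of the unit sphere. -/
lemma integral_cutoffDensity {q : ℝ} (hq : 0 < q) :
    ∫ z : R3, cutoffDensity q (‖z‖ ^ 2) = 4 * Real.pi := by
  rw [integral_fun_norm_addHaar volume fun t => cutoffDensity q (t ^ 2)]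
  simp only [finrank_euclideanSpace, Fintype.card_fin, Nat.add_one_sub_one]
  have hder (t : ℝ) : HasDerivAt (fun t : ℝ => smoothStep (q ^ 2 * t ^ 2))
      (deriv smoothStep (q ^ 2 * t ^ 2) * (q ^ 2 * (2 * t))) t := by
    have := (hasDerivAt_pow 2 t).const_mul (q ^ 2)
    exact (differentiable_smoothStep _).hasDerivAt.comp t (by simpa using this)
  have hcongr : Set.EqOn (fun t : ℝ => t ^ 2 • cutoffDensity q (t ^ 2))
      (fun t => deriv smoothStep (q ^ 2 * t ^ 2) * (q ^ 2 * (2 * t))) (Set.Ioi 0) := by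
    intro t ht
    have ht' : 0 < t := ht
    simp only [cutoffDensity, sq_rpow_neg_half ht'.le, smul_eq_mul]
    field_simp
  have hlim : Tendsto (fun t : ℝ => smoothStep (q ^ 2 * t ^ 2)) atTop (𝓝 1) := by
    refine tendsto_const_nhds.congr' ?_
    filter_upwards [eventually_ge_atTop (2 / q)] with t ht
    rw [div_le_iff₀ hq] at ht
    rw [smoothStep_of_two_le (by nlinarith)]
  rw [setIntegral_congr_fun measurableSet_Ioi hcongr,
    integral_Ioi_of_hasDerivAt_of_nonneg' (fun t _ => hder t) (fun t ht => ?_) hlim]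
  · rw [smoothStep_of_le_one (by simp), Measure.real, EuclideanSpace.volume_ball_fin_three]
    have := Real.pi_pos
    simp [ENNReal.toReal_ofReal (show 0 ≤ Real.pi * 4 / 3 by positivity)]
    ring
  · have ht' : 0 < t := ht
    have := deriv_smoothStep_nonneg (q ^ 2 * t ^ 2)
    positivity

end DiracZeroMode

/-! ### Representation by the fundamental solution -/

namespace DiracZeroMode

open scoped ContDiff

/-- The kernel `α · (y - x) / |y - x|³` applied to a spinor. -/
noncomputable def diracKernel (x y : R3) (v : Spinor) : Spinor :=
  ‖y - x‖ ^ (-3 : ℝ) • alphaDot (y - x) v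

lemma norm_diracKernel (x y : R3) (v : Spinor) :
    ‖diracKernel x y v‖ = ‖x - y‖ ^ (-2 : ℝ) * ‖v‖ := by
  rw [diracKernel, norm_smul, norm_alphaDot, norm_sub_rev, Real.norm_of_nonneg (by positivity),
    ← mul_assoc]
  congr 1
  rcases (norm_nonneg (x - y)).eq_or_lt with h | h
  · rw [← h, mul_zero, Real.zero_rpow (by norm_num)]
  · nth_rewrite 2 [← Real.rpow_one ‖x - y‖]
    rw [← Real.rpow_add h]; norm_num

lemma enorm_diracKernel (x y : R3) (v : Spinor) :
    ‖diracKernel x y v‖ₑ = rieszKernel 2 x y * ‖v‖ₑ := by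
  rw [← ofReal_norm, norm_diracKernel, ENNReal.ofReal_mul (by positivity),
    ofReal_norm, rieszKernel]

lemma aestronglyMeasurable_smul_alphaDot {F : R3 → Spinor} (hF : AEStronglyMeasurable F)
    {w : R3 → ℝ} (hw : Measurable w) (x : R3) :
    AEStronglyMeasurable fun y => w y • alphaDot (y - x) (F y) := by
  have h : AEStronglyMeasurable fun y : R3 => y - x :=
    (continuous_id.sub continuous_const).aestronglyMeasurable
  exact hw.aestronglyMeasurable.smul (alphaDot.aestronglyMeasurable_comp₂ h hF)

lemma aestronglyMeasurable_diracKernel {F : R3 → Spinor} (hF : AEStronglyMeasurable F) (x : R3) :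
    AEStronglyMeasurable fun y => diracKernel x y (F y) :=
  aestronglyMeasurable_smul_alphaDot hF (by fun_prop) x

lemma integrable_diracKernel {F : R3 → Spinor} (hF : AEStronglyMeasurable F) {x : R3}
    (h : ∫⁻ y, rieszKernel 2 x y * ‖F y‖ₑ < ⊤) : Integrable fun y => diracKernel x y (F y) := by
  refine ⟨aestronglyMeasurable_diracKernel hF x, ?_⟩
  simpa only [HasFiniteIntegral, enorm_diracKernel] using h

lemma integrable_cutoffDensity_smul {f : R3 → Spinor} (hf : LocallyIntegrable f) {q : ℝ}
    (hq : 0 < q) (x : R3) : Integrable fun y => cutoffDensity q (‖y - x‖ ^ 2) • f y := by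
  obtain ⟨B, hB0, hB⟩ := exists_cutoffDensity_le
  have hm : Measurable fun y : R3 => cutoffDensity q (‖y - x‖ ^ 2) :=
    (measurable_cutoffDensity q).comp (by fun_prop)
  have h1 : IntegrableOn (fun y => cutoffDensity q (‖y - x‖ ^ 2) • f y)
      (Metric.closedBall x (2 / q)) := by
    refine (hf.integrableOn_isCompact (isCompact_closedBall _ _)).bdd_smul (B * q ^ 3)
      hm.aestronglyMeasurable (ae_of_all _ fun y => ?_)
    rw [Real.norm_of_nonneg (cutoffDensity_nonneg _ (by positivity))]
    exact hB q _ hq (norm_nonneg _)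
  refine (integrableOn_iff_integrable_of_support_subset fun y hy => ?_).1 h1
  by_contra hcon
  rw [Metric.mem_closedBall, dist_eq_norm, not_le] at hcon
  exact hy (by simp only [cutoffDensity_of_lt hq hcon, zero_smul])

lemma volume_real_closedBall_two_div {q : ℝ} (hq : 0 < q) (x : R3) :
    volume.real (Metric.closedBall x (2 / q)) = 32 / 3 * Real.pi / q ^ 3 := by
  rw [Measure.real, EuclideanSpace.volume_closedBall_fin_three]
  have := Real.pi_pos
  simp [ENNReal.toReal_ofReal (show 0 ≤ Real.pi * 4 / 3 by positivity),
    ENNReal.toReal_ofReal (show 0 ≤ 2 / q by positivity)]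
  field_simp; norm_num

/-- The mass `4π` lets `f x` be subtracted under the integral, and the height `q³` matches the
inverse volume of the ball of radius `2/q`; the error is thus a mean oscillation, which tends to
zero at Lebesgue points. -/
lemma exists_norm_integral_cutoffDensity_sub_le : ∃ C : ℝ, ∀ f : R3 → Spinor,
    LocallyIntegrable f → ∀ q : ℝ, 0 < q → ∀ x,
      ‖(∫ y, cutoffDensity q (‖y - x‖ ^ 2) • f y) - (4 * Real.pi) • f x‖ ≤
        C * ⨍ y in Metric.closedBall x (2 / q), ‖f y - f x‖ := by
  obtain ⟨B, hB0, hB⟩ := exists_cutoffDensity_le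
  refine ⟨B * (32 / 3 * Real.pi), fun f hf q hq x => ?_⟩
  have hsupp (y : R3) (hy : y ∉ Metric.closedBall x (2 / q)) :
      cutoffDensity q (‖y - x‖ ^ 2) = 0 := by
    rw [Metric.mem_closedBall, dist_eq_norm, not_le] at hy
    exact cutoffDensity_of_lt hq hy
  have hbd (y : R3) : ‖cutoffDensity q (‖y - x‖ ^ 2)‖ ≤ B * q ^ 3 := by
    rw [Real.norm_of_nonneg (cutoffDensity_nonneg q (by positivity))]
    exact hB q _ hq (norm_nonneg _)
  have hfc : LocallyIntegrable fun y => f y - f x := hf.sub (locallyIntegrable_const _)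
  have hone : ∫ y, cutoffDensity q (‖y - x‖ ^ 2) • f x = (4 * Real.pi) • f x := by
    rw [integral_smul_const, integral_sub_right_eq_self (fun z : R3 => cutoffDensity q (‖z‖ ^ 2)) x,
      integral_cutoffDensity hq]
  rw [← hone, ← integral_sub (integrable_cutoffDensity_smul hf hq x)
    (integrable_cutoffDensity_smul (locallyIntegrable_const _) hq x)]
  simp only [← smul_sub]
  rw [← setIntegral_eq_integral_of_forall_compl_eq_zero (s := Metric.closedBall x (2 / q))
    fun y hy => by rw [hsupp y hy, zero_smul]]
  refine (norm_integral_le_integral_norm _).trans ?_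
  calc ∫ y in Metric.closedBall x (2 / q), ‖cutoffDensity q (‖y - x‖ ^ 2) • (f y - f x)‖
      ≤ ∫ y in Metric.closedBall x (2 / q), B * q ^ 3 * ‖f y - f x‖ := by
        refine integral_mono (integrable_cutoffDensity_smul hfc hq x).norm.integrableOn
          ((hfc.integrableOn_isCompact (isCompact_closedBall _ _)).norm.const_mul _) fun y => ?_
        simp only [norm_smul]
        gcongr
        exact hbd y
    _ = B * (32 / 3 * Real.pi) * ⨍ y in Metric.closedBall x (2 / q), ‖f y - f x‖ := by
        rw [integral_const_mul, setAverage_eq, volume_real_closedBall_two_div hq, smul_eq_mul]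
        have := Real.pi_pos
        field_simp

/-- At Lebesgue points, averaging against `cutoffDensity q` recovers the function as `q → ∞`. -/
lemma ae_tendsto_integral_cutoffDensity {f : R3 → Spinor} (hf : LocallyIntegrable f) :
    ∀ᵐ x, Tendsto (fun q : ℝ => ∫ y, cutoffDensity q (‖y - x‖ ^ 2) • f y) atTop
      (𝓝 ((4 * Real.pi) • f x)) := by
  obtain ⟨C, hC⟩ := exists_norm_integral_cutoffDensity_sub_le
  have hδ : Tendsto (fun q : ℝ => 2 / q) atTop (𝓝[>] 0) := by
    refine tendsto_nhdsWithin_iff.2 ⟨tendsto_const_nhds.div_atTop tendsto_id, ?_⟩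
    filter_upwards [eventually_gt_atTop 0] with q hq
    exact div_pos two_pos hq
  filter_upwards [IsUnifLocDoublingMeasure.ae_tendsto_average_norm_sub volume hf 1] with x hx
  have hav := hx (l := atTop) (fun _ : ℝ => x) (fun q => 2 / q) hδ (by
    filter_upwards [eventually_gt_atTop 0] with q hq
    exact Metric.mem_closedBall_self (by positivity))
  rw [tendsto_iff_norm_sub_tendsto_zero]
  refine squeeze_zero' (.of_forall fun _ => norm_nonneg _) ?_ (by simpa using hav.const_mul C)
  filter_upwards [eventually_gt_atTop 0] with q hq using hC f hf q hq x

/-- The averages against `cutoffDensity q` of a square integrable function vanish as `q → 0`. -/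
lemma tendsto_integral_cutoffDensity_inv {f : R3 → Spinor} (hf : MemLp f 2) (x : R3) :
    Tendsto (fun q : ℝ => ∫ y, cutoffDensity q⁻¹ (‖y - x‖ ^ 2) • f y) atTop (𝓝 0) := by
  obtain ⟨B, hB0, hB⟩ := exists_cutoffDensity_le_one_add
  have hw : MemLp (fun y : R3 => (1 + ‖y - x‖) ^ (-3 : ℝ)) 2 := by
    rw [memLp_two_iff_integrable_sq (Measurable.aestronglyMeasurable (by fun_prop))]
    have h6 : Integrable fun z : R3 => (1 + ‖z‖) ^ (-6 : ℝ) :=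
      integrable_one_add_norm (by norm_num)
    refine (h6.comp_sub_right x).congr (ae_of_all _ fun y => ?_)
    simp only
    rw [← Real.rpow_natCast, ← Real.rpow_mul (by positivity)]
    norm_num
  rw [← integral_zero R3 Spinor]
  refine tendsto_integral_filter_of_dominated_convergence
    (fun y => B * ((1 + ‖y - x‖) ^ (-3 : ℝ) * ‖f y‖)) (.of_forall fun q => ?_) ?_
    ((hw.integrable_mul hf.norm).const_mul B) (ae_of_all _ fun y => ?_)
  · exact ((measurable_cutoffDensity _).comp (by fun_prop)).aestronglyMeasurable.smul hf.1
  · filter_upwards [eventually_ge_atTop 1] with q hq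
    refine ae_of_all _ fun y => ?_
    rw [norm_smul, Real.norm_of_nonneg (cutoffDensity_nonneg _ (by positivity)), ← mul_assoc]
    gcongr
    exact hB _ _ (by positivity) (inv_le_one_of_one_le₀ hq) (norm_nonneg _)
  · refine tendsto_const_nhds.congr' ?_
    filter_upwards [eventually_gt_atTop ‖y - x‖] with q hq
    have : 0 < q := (norm_nonneg _).trans_lt hq
    rw [cutoffDensity_of_lt_inv (by positivity) (norm_nonneg _) (by rwa [inv_inv]), zero_smul]

lemma sq_rpow_neg_three_half {t : ℝ} (ht : 0 ≤ t) : (t ^ 2) ^ (-(3 / 2) : ℝ) = t ^ (-3 : ℝ) := by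
  rw [← Real.rpow_natCast, ← Real.rpow_mul ht]
  norm_num

lemma cutoffProfile_smul_alphaDot (q : ℝ) (x y : R3) (v : Spinor) :
    cutoffProfile q (‖y - x‖ ^ 2) • alphaDot (y - x) v =
      smoothStep (q ^ 2 * ‖y - x‖ ^ 2) • diracKernel x y v := by
  rw [cutoffProfile, diracKernel, sq_rpow_neg_three_half (norm_nonneg _), smul_smul, mul_comm]

/-- The integral representation of a solution of the Dirac equation by the fundamental solution. -/
lemma ae_eq_integral_diracKernel {Q : R3 → Matrix (Fin 4) (Fin 4) ℂ} {f : R3 → Spinor}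
    {df : Fin 3 → R3 → Spinor} (hs : IsSobolevOneWithGradient f df)
    (hd : diracExpr Q f df =ᵐ[volume] 0) (hF : AEStronglyMeasurable (potentialMul Q f))
    (hfin : ∀ᵐ x, ∫⁻ y, rieszKernel 2 x y * ‖potentialMul Q f y‖ₑ < ⊤) :
    ∀ᵐ x, (4 * Real.pi) • f x = Complex.I • ∫ y, diracKernel x y (potentialMul Q f y) := by
  have hloc := hs.memLp.locallyIntegrable (by norm_num)
  filter_upwards [ae_tendsto_integral_cutoffDensity hloc, hfin] with x hx hfx
  set F := potentialMul Q f with hFdef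
  have hInt := integrable_diracKernel hF hfx
  have hid : ∀ᶠ q : ℝ in atTop, (∫ y, cutoffDensity q (‖y - x‖ ^ 2) • f y) -
      ∫ y, cutoffDensity q⁻¹ (‖y - x‖ ^ 2) • f y =
      Complex.I • ∫ y, (smoothStep (q ^ 2 * ‖y - x‖ ^ 2) - smoothStep (q⁻¹ ^ 2 * ‖y - x‖ ^ 2)) •
        diracKernel x y (F y) := by
    filter_upwards [eventually_ge_atTop 1] with q hq
    have hq0 : 0 < q := by linarith
    -- Far out both profiles equal `s ^ (-3/2)`, so their difference has compact support and is an
    -- admissible test profile.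
    have hvanish : ∀ s, (2 * q) ^ 2 ≤ s → cutoffProfile q s - cutoffProfile q⁻¹ s = 0 := by
      intro s hs
      have h1 : 2 ≤ q⁻¹ ^ 2 * s := by
        rw [inv_pow, ← div_eq_inv_mul, le_div_iff₀ (by positivity)]; nlinarith
      have h2 : 2 ≤ q ^ 2 * s := by
        have hs4 : 4 ≤ s := by nlinarith
        nlinarith [one_le_pow₀ hq (n := 2)]
      rw [cutoffProfile, cutoffProfile, smoothStep_of_two_le h1, smoothStep_of_two_le h2, sub_self]
    have key := integral_radial_smul_eq hs hd
      ((contDiff_cutoffProfile q).sub (contDiff_cutoffProfile q⁻¹)) hvanish x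
    rw [← integral_sub (integrable_cutoffDensity_smul hloc hq0 x)
      (integrable_cutoffDensity_smul hloc (inv_pos.2 hq0) x)]
    convert key using 2
    · ext1 y
      have hdq (p : ℝ) := ((contDiff_cutoffProfile p).differentiable (by simp)) (‖y - x‖ ^ 2)
      rw [← sub_smul, ← two_mul_deriv_cutoffProfile_add, ← two_mul_deriv_cutoffProfile_add,
        deriv_fun_sub (hdq q) (hdq q⁻¹)]
      congr 1; ring
    · congr 1
      ext1 y
      rw [sub_smul, sub_smul, cutoffProfile_smul_alphaDot, cutoffProfile_smul_alphaDot]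
  have hlim1 := hx.sub (tendsto_integral_cutoffDensity_inv hs.memLp x)
  rw [sub_zero] at hlim1
  refine tendsto_nhds_unique (hlim1.congr' hid) (Tendsto.const_smul ?_ _)
  refine tendsto_integral_filter_of_dominated_convergence (fun y => ‖diracKernel x y (F y)‖)
    (.of_forall fun q => ?_) (.of_forall fun q => ae_of_all _ fun y => ?_) hInt.norm
    (ae_of_all _ fun y => ?_)
  · have := (contDiff_smoothStep.continuous).measurable
    exact (by fun_prop : Measurable fun y : R3 => smoothStep (q ^ 2 * ‖y - x‖ ^ 2) -
      smoothStep (q⁻¹ ^ 2 * ‖y - x‖ ^ 2)).aestronglyMeasurable.smul hInt.1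
  · rw [norm_smul]
    refine mul_le_of_le_one_left (norm_nonneg _) ?_
    rw [Real.norm_eq_abs, abs_le]
    constructor <;> linarith [smoothStep_nonneg (q ^ 2 * ‖y - x‖ ^ 2),
      smoothStep_nonneg (q⁻¹ ^ 2 * ‖y - x‖ ^ 2), smoothStep_le_one (q ^ 2 * ‖y - x‖ ^ 2),
      smoothStep_le_one (q⁻¹ ^ 2 * ‖y - x‖ ^ 2)]
  · rcases (norm_nonneg (y - x)).eq_or_lt with h | h
    · have : y - x = 0 := norm_eq_zero.1 h.symm
      simp [diracKernel, this]
    · refine tendsto_const_nhds.congr' ?_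
      filter_upwards [eventually_ge_atTop (2 / ‖y - x‖), eventually_ge_atTop ‖y - x‖] with q h1 h2
      have hq0 : 0 < q := h.trans_le h2
      rw [div_le_iff₀ h] at h1
      rw [smoothStep_of_two_le (by nlinarith), smoothStep_of_le_one, sub_zero, one_smul]
      rw [inv_pow, ← div_eq_inv_mul]
      exact div_le_one_of_le₀ (by gcongr) (by positivity)

end DiracZeroMode

/-! ### Continuity and asymptotics of the potential -/

namespace DiracZeroMode

open scoped ENNReal NNReal

lemma integrable_of_enorm_le_decayWeight {F : R3 → Spinor} (hF : AEStronglyMeasurable F)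
    {C : ℝ≥0} {δ : ℝ} (hδ : 0 < δ) (hC : ∀ᵐ y, ‖F y‖ₑ ≤ C * decayWeight (3 + δ) y) :
    Integrable F := by
  refine ⟨hF, ?_⟩
  calc ∫⁻ y, ‖F y‖ₑ ≤ ∫⁻ y, C * decayWeight (3 + δ) y := lintegral_mono_ae hC
    _ = C * ∫⁻ y, decayWeight (3 + δ) y := lintegral_const_mul' _ _ ENNReal.coe_ne_top
    _ < ∞ := ENNReal.mul_lt_top ENNReal.coe_lt_top
      (finite_integral_one_add_norm (E := R3) (by simpa using hδ))

lemma lintegral_rieszKernel_lt_top_of_enorm_le {F : R3 → Spinor} {C : ℝ≥0} {δ : ℝ} (hδ : 0 < δ)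
    (hC : ∀ᵐ y, ‖F y‖ₑ ≤ C * decayWeight (3 + δ) y) (x : R3) :
    ∫⁻ y, rieszKernel 2 x y * ‖F y‖ₑ < ∞ := by
  obtain ⟨M, hM⟩ := exists_lintegral_rieszKernel_mul_decayWeight_le (a := 2) (b := 3 + δ) (t := 0)
    le_rfl (by norm_num) (by norm_num) (by linarith)
  calc ∫⁻ y, rieszKernel 2 x y * ‖F y‖ₑ
      ≤ ∫⁻ y, C * (rieszKernel 2 x y * decayWeight (3 + δ) y) := by
        refine lintegral_mono_ae ?_
        filter_upwards [hC] with y hy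
        rw [mul_left_comm]
        gcongr
    _ = C * ∫⁻ y, rieszKernel 2 x y * decayWeight (3 + δ) y :=
        lintegral_const_mul' _ _ ENNReal.coe_ne_top
    _ < ∞ := ENNReal.mul_lt_top ENNReal.coe_lt_top ((hM x).trans_lt
        (ENNReal.mul_lt_top ENNReal.coe_lt_top (decayWeight_ne_top 0 x).lt_top))

/-- The potential `∫ α · (y - x) / |y - x|³ F(y) dy`. -/
noncomputable def diracPotential (F : R3 → Spinor) (x : R3) : Spinor :=
  ∫ y, diracKernel x y (F y)

lemma smoothStep_mul_rpow_le {q t : ℝ} (hq : 0 < q) (ht : 0 ≤ t) :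
    smoothStep (q ^ 2 * t ^ 2) * t ^ (-2 : ℝ) ≤ q ^ 2 := by
  by_cases h : q * t < 1
  · have h0 : 0 ≤ q * t := by positivity
    rw [smoothStep_of_le_one (by nlinarith), zero_mul]; positivity
  · have ht0 : 0 < t := by
      rcases ht.eq_or_lt with h' | h'
      · rw [← h', mul_zero] at h; linarith
      · exact h'
    calc smoothStep (q ^ 2 * t ^ 2) * t ^ (-2 : ℝ) ≤ 1 * t ^ (-2 : ℝ) := by
          gcongr; exact smoothStep_le_one _
      _ ≤ q ^ 2 := by
          rw [one_mul, Real.rpow_neg ht, Real.rpow_two]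
          rw [inv_le_iff_one_le_mul₀ (by positivity)]
          nlinarith

lemma continuous_integral_cutoffProfile {F : R3 → Spinor} (hF : Integrable F) {q : ℝ}
    (hq : 0 < q) :
    Continuous fun x => ∫ y, cutoffProfile q (‖y - x‖ ^ 2) • alphaDot (y - x) (F y) := by
  have hc := (contDiff_cutoffProfile q).continuous
  refine continuous_of_dominated (bound := fun y => q ^ 2 * ‖F y‖) (fun x => ?_)
    (fun x => ae_of_all _ fun y => ?_) (hF.norm.const_mul _) (ae_of_all _ fun y => ?_)
  · exact aestronglyMeasurable_smul_alphaDot hF.1 (hc.comp (by fun_prop)).measurable x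
  · rw [cutoffProfile_smul_alphaDot, norm_smul, norm_diracKernel, norm_sub_rev x y, ← mul_assoc,
      Real.norm_of_nonneg (smoothStep_nonneg _)]
    gcongr
    exact smoothStep_mul_rpow_le hq (norm_nonneg _)
  · have h1 : Continuous fun x : R3 => alphaDot (y - x) (F y) :=
      (alphaDot.flip (F y)).continuous.comp (continuous_const.sub continuous_id)
    exact (hc.comp (by fun_prop)).smul h1

/-- The cutoff changes the kernel only in the ball of radius `2/q` about `x`, where `F` is bounded
by `C` and the kernel has integral `4π · 2/q`, uniformly in `x`. -/
lemma enorm_integral_cutoffProfile_sub_le {F : R3 → Spinor} (hF : AEStronglyMeasurable F)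
    {C : ℝ≥0} {δ : ℝ} (hδ : 0 < δ) (hC : ∀ᵐ y, ‖F y‖ₑ ≤ C * decayWeight (3 + δ) y) {q : ℝ}
    (hq : 0 < q) (x : R3) :
    ‖diracPotential F x - ∫ y, cutoffProfile q (‖y - x‖ ^ 2) • alphaDot (y - x) (F y)‖ₑ ≤
      ENNReal.ofReal (C * (4 * Real.pi * (2 / q))) := by
  have hInt := integrable_diracKernel hF (lintegral_rieszKernel_lt_top_of_enorm_le hδ hC x)
  have hm : Measurable fun y : R3 => smoothStep (q ^ 2 * ‖y - x‖ ^ 2) :=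
    contDiff_smoothStep.continuous.measurable.comp (by fun_prop)
  simp only [cutoffProfile_smul_alphaDot, diracPotential]
  have hInt' : Integrable fun y =>
      smoothStep (q ^ 2 * ‖y - x‖ ^ 2) • diracKernel x y (F y) :=
    hInt.bdd_smul 1 hm.aestronglyMeasurable (ae_of_all _ fun y => by
      rw [Real.norm_of_nonneg (smoothStep_nonneg _)]; exact smoothStep_le_one _)
  rw [← integral_sub hInt hInt']
  refine (enorm_integral_le_lintegral_enorm _).trans ?_
  calc ∫⁻ y, ‖diracKernel x y (F y) - smoothStep (q ^ 2 * ‖y - x‖ ^ 2) • diracKernel x y (F y)‖ₑ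
      ≤ ∫⁻ y, (Metric.ball x (2 / q)).indicator (fun y => C * rieszKernel 2 x y) y := by
        refine lintegral_mono_ae ?_
        filter_upwards [hC] with y hy
        by_cases hyb : y ∈ Metric.ball x (2 / q)
        · rw [Set.indicator_of_mem hyb]
          have h1 : diracKernel x y (F y) - smoothStep (q ^ 2 * ‖y - x‖ ^ 2) •
              diracKernel x y (F y) =
              (1 - smoothStep (q ^ 2 * ‖y - x‖ ^ 2)) • diracKernel x y (F y) := by
            rw [sub_smul, one_smul]
          rw [h1, enorm_smul, enorm_diracKernel]
          have h2 : ‖1 - smoothStep (q ^ 2 * ‖y - x‖ ^ 2)‖ₑ ≤ 1 := by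
            rw [← ofReal_norm, ENNReal.ofReal_le_one, Real.norm_eq_abs, abs_le]
            constructor <;> linarith [smoothStep_nonneg (q ^ 2 * ‖y - x‖ ^ 2),
              smoothStep_le_one (q ^ 2 * ‖y - x‖ ^ 2)]
          calc _ ≤ 1 * (rieszKernel 2 x y * (C * 1)) := by
                gcongr
                exact hy.trans (by gcongr; exact decayWeight_le_one (by linarith) y)
            _ = _ := by ring
        · rw [Set.indicator_of_notMem hyb, smoothStep_of_two_le, one_smul, sub_self, enorm_zero]
          rw [Metric.mem_ball, dist_eq_norm, not_lt, div_le_iff₀ hq] at hyb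
          nlinarith
    _ = C * ENNReal.ofReal (4 * Real.pi * (2 / q)) := by
        rw [lintegral_indicator measurableSet_ball, lintegral_const_mul' _ _ ENNReal.coe_ne_top,
          lintegral_ball_rieszKernel (by norm_num) (by positivity)]
        norm_num
    _ = _ := by
        rw [ENNReal.ofReal_mul C.coe_nonneg, ENNReal.ofReal_coe_nnreal]

/-- A uniform limit of truncated potentials; these are continuous by dominated convergence, their
kernels being bounded by `q²`. -/
lemma continuous_diracPotential {F : R3 → Spinor} (hF : AEStronglyMeasurable F)
    {C : ℝ≥0} {δ : ℝ} (hδ : 0 < δ) (hC : ∀ᵐ y, ‖F y‖ₑ ≤ C * decayWeight (3 + δ) y) :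
    Continuous (diracPotential F) := by
  have hlim : Tendsto (fun q : ℝ => C * (4 * Real.pi * (2 / q))) atTop (𝓝 0) := by
    have : Tendsto (fun q : ℝ => 2 / q) atTop (𝓝 0) := tendsto_const_nhds.div_atTop tendsto_id
    simpa using (this.const_mul (4 * Real.pi)).const_mul (C : ℝ)
  have hunif : TendstoUniformly (fun (q : ℝ) x =>
      ∫ y, cutoffProfile q (‖y - x‖ ^ 2) • alphaDot (y - x) (F y)) (diracPotential F) atTop := by
    rw [Metric.tendstoUniformly_iff]
    intro ε hε
    filter_upwards [hlim.eventually_lt_const hε, eventually_gt_atTop 0] with q h1 hq x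
    have h2 := enorm_integral_cutoffProfile_sub_le hF hδ hC hq x
    rw [← ofReal_norm, ENNReal.ofReal_le_ofReal_iff (by have := Real.pi_pos; positivity)] at h2
    rw [dist_eq_norm]
    exact h2.trans_lt h1
  refine hunif.continuous (Eventually.frequently ?_)
  filter_upwards [eventually_gt_atTop 0] with q hq
  exact continuous_integral_cutoffProfile (integrable_of_enorm_le_decayWeight hF hδ hC) hq

/-- By homogeneity of degree `-2`, `r²` times the kernel at `(rω, y)` is the kernel at `(ω, y/r)`.
-/
lemma tendsto_sq_smul_diracKernel {ω : R3} (hω : ‖ω‖ = 1) (y : R3) (v : Spinor) :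
    Tendsto (fun r : ℝ => r ^ 2 • diracKernel (r • ω) y v) atTop (𝓝 (-alphaDot ω v)) := by
  have h0 : Tendsto (fun r : ℝ => r⁻¹ • y - ω) atTop (𝓝 (-ω)) := by
    have h : Tendsto (fun r : ℝ => r⁻¹ • y) atTop (𝓝 ((0 : ℝ) • y)) :=
      tendsto_inv_atTop_zero.smul_const y
    simpa using h.sub_const ω
  have h1 : Tendsto (fun r : ℝ => ‖r⁻¹ • y - ω‖ ^ (-3 : ℝ) • alphaDot (r⁻¹ • y - ω) v) atTop
      (𝓝 (‖-ω‖ ^ (-3 : ℝ) • alphaDot (-ω) v)) := by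
    refine Tendsto.smul (h0.norm.rpow_const (Or.inl (by simp [hω]))) ?_
    exact ((alphaDot.flip v).continuous.tendsto _).comp h0
  rw [norm_neg, hω, Real.one_rpow, one_smul] at h1
  have h2 : alphaDot (-ω) v = -alphaDot ω v := by simp
  rw [← h2]
  refine h1.congr' ?_
  filter_upwards [eventually_gt_atTop 0] with r hr
  have h3 : y - r • ω = r • (r⁻¹ • y - ω) := by
    rw [smul_sub, smul_smul, mul_inv_cancel₀ hr.ne', one_smul]
  rw [diracKernel, h3, norm_smul, Real.norm_of_nonneg hr.le,
    Real.mul_rpow hr.le (norm_nonneg _), map_smul, smul_apply, smul_smul,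
    smul_smul]
  congr 1
  rw [Real.rpow_neg hr.le]
  norm_cast
  field_simp

lemma enorm_setIntegral_diracKernel_le {F : R3 → Spinor} {C : ℝ≥0} {δ : ℝ} (hδ : 0 < δ)
    (hC : ∀ᵐ y, ‖F y‖ₑ ≤ C * decayWeight (3 + δ) y) (x : R3) {r : ℝ} (hr : r = (1 + ‖x‖) / 2) :
    ‖∫ y in Metric.ball x r, diracKernel x y (F y)‖ₑ ≤
      ENNReal.ofReal (C * (r ^ (-(3 + δ)) * (4 * Real.pi * r))) := by
  have hr0 : 0 < r := by rw [hr]; positivity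
  calc ‖∫ y in Metric.ball x r, diracKernel x y (F y)‖ₑ
      ≤ ∫⁻ y in Metric.ball x r, rieszKernel 2 x y * ‖F y‖ₑ := by
        simpa only [enorm_diracKernel] using
          enorm_integral_le_lintegral_enorm fun y => diracKernel x y (F y)
    _ ≤ ∫⁻ y in Metric.ball x r, C * (ENNReal.ofReal (r ^ (-(3 + δ))) * rieszKernel 2 x y) := by
        refine lintegral_mono_ae ?_
        filter_upwards [ae_restrict_of_ae hC, ae_restrict_mem measurableSet_ball] with y hy hyb
        have hy' : ‖x - y‖ < r := by rwa [Metric.mem_ball', dist_eq_norm] at hyb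
        have hw : decayWeight (3 + δ) y ≤ ENNReal.ofReal (r ^ (-(3 + δ))) := by
          refine ENNReal.ofReal_le_ofReal (Real.rpow_le_rpow_of_nonpos hr0 ?_ (by linarith))
          linarith [norm_sub_norm_le x y]
        calc _ ≤ rieszKernel 2 x y * (C * ENNReal.ofReal (r ^ (-(3 + δ)))) := by
              gcongr; exact hy.trans (by gcongr)
          _ = _ := by ring
    _ = _ := by
        rw [lintegral_const_mul' _ _ ENNReal.coe_ne_top,
          lintegral_const_mul' _ _ ENNReal.ofReal_ne_top,
          lintegral_ball_rieszKernel (by norm_num) hr0, ENNReal.ofReal_mul C.coe_nonneg,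
          ENNReal.ofReal_mul (Real.rpow_nonneg hr0.le _), ENNReal.ofReal_coe_nnreal,
          show (3 - 2 : ℝ) = 1 by norm_num, Real.rpow_one, div_one]

/-- The leading term of the potential at infinity. -/
lemma tendsto_sq_smul_diracPotential {F : R3 → Spinor} (hF : AEStronglyMeasurable F)
    {C : ℝ≥0} {δ : ℝ} (hδ : 0 < δ) (hC : ∀ᵐ y, ‖F y‖ₑ ≤ C * decayWeight (3 + δ) y) {ω : R3}
    (hω : ‖ω‖ = 1) :
    Tendsto (fun r : ℝ => r ^ 2 • diracPotential F (r • ω)) atTop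
      (𝓝 (-alphaDot ω (∫ y, F y))) := by
  have hFi := integrable_of_enorm_le_decayWeight hF hδ hC
  set S : ℝ → Set R3 := fun r => Metric.ball (r • ω) ((1 + r) / 2) with hS
  have hnorm {r : ℝ} (hr : 0 < r) : ‖r • ω‖ = r := by
    rw [norm_smul, hω, mul_one, Real.norm_of_nonneg hr.le]
  -- Near `rω` the kernel is singular, but `F` is of size `r^(-3-δ)` there and the kernel has
  -- integral of order `r`, so the contribution after multiplication by `r²` is `O(r^(-δ))`.
  have hnear : Tendsto (fun r : ℝ => r ^ 2 • ∫ y in S r, diracKernel (r • ω) y (F y)) atTop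
      (𝓝 0) := by
    have hlim : Tendsto (fun r : ℝ => 16 * Real.pi * C * ((1 + r) / 2) ^ (-δ)) atTop (𝓝 0) := by
      have h1 : Tendsto (fun r : ℝ => (1 + r) / 2) atTop atTop :=
        (tendsto_atTop_add_const_left _ _ tendsto_id).atTop_div_const two_pos
      simpa using ((tendsto_rpow_neg_atTop hδ).comp h1).const_mul (16 * Real.pi * C)
    refine squeeze_zero_norm' ?_ hlim
    filter_upwards [eventually_gt_atTop 0] with r hr
    have hpi := Real.pi_pos
    set p : ℝ := (1 + r) / 2 with hp
    have hp0 : 0 < p := by positivity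
    have h1 := enorm_setIntegral_diracKernel_le hδ hC (r • ω) (r := p) (by rw [hnorm hr])
    rw [← ofReal_norm, ENNReal.ofReal_le_ofReal_iff (by positivity)] at h1
    rw [norm_smul, Real.norm_of_nonneg (by positivity)]
    have hrp : r ≤ 2 * p := by rw [hp]; linarith
    calc r ^ 2 * ‖∫ y in S r, diracKernel (r • ω) y (F y)‖
        ≤ (2 * p) ^ 2 * (C * (p ^ (-(3 + δ)) * (4 * Real.pi * p))) := by gcongr
      _ = 16 * Real.pi * C * (p ^ (3 : ℕ) * p ^ (-(3 + δ))) := by ring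
      _ = 16 * Real.pi * C * p ^ (-δ) := by
          rw [← Real.rpow_natCast, ← Real.rpow_add hp0]
          congr 2; push_cast; ring
  -- Off the ball `|rω - y| ≥ r/2`, so `r²` times the kernel is at most `4` in norm and `4 |F|`
  -- dominates.
  have hfar : Tendsto (fun r : ℝ => ∫ y, (S r)ᶜ.indicator
      (fun y => r ^ 2 • diracKernel (r • ω) y (F y)) y) atTop (𝓝 (∫ y, -alphaDot ω (F y))) := by
    refine tendsto_integral_filter_of_dominated_convergence (fun y => 4 * ‖F y‖)
      (.of_forall fun r => ?_) ?_ (hFi.norm.const_mul 4) (ae_of_all _ fun y => ?_)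
    · exact ((aestronglyMeasurable_diracKernel hF (r • ω)).const_smul (r ^ 2)).indicator
        measurableSet_ball.compl
    · filter_upwards [eventually_gt_atTop 0] with r hr
      refine ae_of_all _ fun y => ?_
      by_cases hy : y ∈ (S r)ᶜ
      · rw [Set.indicator_of_mem hy, norm_smul, norm_diracKernel, ← mul_assoc,
          Real.norm_of_nonneg (by positivity)]
        gcongr
        rw [Set.mem_compl_iff, hS, Metric.mem_ball', dist_eq_norm, not_lt] at hy
        have hz : r / 2 ≤ ‖r • ω - y‖ := by linarith
        calc r ^ 2 * ‖r • ω - y‖ ^ (-2 : ℝ) ≤ r ^ 2 * (r / 2) ^ (-2 : ℝ) := by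
              exact mul_le_mul_of_nonneg_left
                (Real.rpow_le_rpow_of_nonpos (by positivity) hz (by norm_num)) (by positivity)
          _ = 4 := by
              rw [Real.rpow_neg (by positivity), Real.rpow_two]
              field_simp; norm_num
      · rw [Set.indicator_of_notMem hy, norm_zero]; positivity
    · refine (tendsto_sq_smul_diracKernel hω y (F y)).congr' ?_
      filter_upwards [eventually_ge_atTop (1 + 2 * ‖y‖), eventually_gt_atTop 0] with r h1 hr
      rw [Set.indicator_of_mem]
      rw [Set.mem_compl_iff, hS, Metric.mem_ball', dist_eq_norm, not_lt]
      have := norm_sub_norm_le (r • ω) y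
      rw [hnorm hr] at this
      linarith
  have hval : ∫ y, -alphaDot ω (F y) = -alphaDot ω (∫ y, F y) := by
    rw [integral_neg, (alphaDot ω).integral_comp_comm hFi]
  have hsum := hnear.add hfar
  rw [zero_add, hval] at hsum
  refine hsum.congr fun r => ?_
  have hInt := integrable_diracKernel hF (lintegral_rieszKernel_lt_top_of_enorm_le hδ hC (r • ω))
  rw [integral_indicator measurableSet_ball.compl, integral_smul, ← smul_add,
    integral_add_compl measurableSet_ball hInt, diracPotential]

end DiracZeroMode

/-! ### Decay of zero modes and the theorem -/

namespace DiracZeroMode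

open scoped ENNReal NNReal

lemma potentialMul_eq_sum (Q : R3 → Matrix (Fin 4) (Fin 4) ℂ) (f : R3 → Spinor) (y : R3) :
    potentialMul Q f y = ∑ j, ∑ k, (Q y j k * f y k) • EuclideanSpace.single j (1 : ℂ) := by
  ext i
  simp [potentialMul, Matrix.toLpLin_apply, Matrix.mulVec, dotProduct, ← Finset.sum_smul,
    Pi.single_apply]

lemma aestronglyMeasurable_potentialMul {Q : R3 → Matrix (Fin 4) (Fin 4) ℂ} {f : R3 → Spinor}
    (hQ : ∀ j k, AEMeasurable (fun x => Q x j k) volume) (hf : AEStronglyMeasurable f) :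
    AEStronglyMeasurable (potentialMul Q f) := by
  have h (k : Fin 4) : AEStronglyMeasurable fun y => f y k :=
    (EuclideanSpace.proj k : Spinor →L[ℂ] ℂ).continuous.comp_aestronglyMeasurable hf
  have e : potentialMul Q f = fun y =>
      ∑ j, ∑ k, (Q y j k * f y k) • EuclideanSpace.single j (1 : ℂ) :=
    funext (potentialMul_eq_sum Q f)
  rw [e]
  refine Finset.aestronglyMeasurable_fun_sum _ fun j _ =>
    Finset.aestronglyMeasurable_fun_sum _ fun k _ => ?_
  exact ((hQ j k).aestronglyMeasurable.mul (h k)).smul_const _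

lemma IsAdmissiblePotential.exists_enorm_potentialMul_le {Q : R3 → Matrix (Fin 4) (Fin 4) ℂ}
    (hQ : IsAdmissiblePotential Q) : ∃ ρ : ℝ, 1 < ρ ∧ ∃ K : ℝ≥0, ∀ (f : R3 → Spinor) (y : R3),
      ‖potentialMul Q f y‖ₑ ≤ K * (decayWeight ρ y * ‖f y‖ₑ) := by
  obtain ⟨ρ, C, hρ, hC, hQd⟩ := hQ.decay
  -- Sixteen matrix entries, and `1 + |y| ≤ √2 √(1 + |y|²)` raised to the power `ρ`.
  refine ⟨ρ, hρ, (16 * (C * √2 ^ ρ)).toNNReal, fun f y => ?_⟩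
  have hw : √(1 + ‖y‖ ^ 2) ^ (-ρ) ≤ √2 ^ ρ * (1 + ‖y‖) ^ (-ρ) := by
    have h1 : (1 + ‖y‖) / √2 ≤ √(1 + ‖y‖ ^ 2) := by
      rw [div_le_iff₀' (by positivity)]
      exact one_add_norm_le_sqrt_two_mul_sqrt y
    refine (Real.rpow_le_rpow_of_nonpos (by positivity) h1 (by linarith)).trans_eq ?_
    rw [Real.div_rpow (by positivity) (by positivity), Real.rpow_neg (x := √2) (by positivity),
      div_inv_eq_mul, mul_comm]
  have hnorm : ‖potentialMul Q f y‖ ≤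
      16 * (C * √2 ^ ρ) * ((1 + ‖y‖) ^ (-ρ) * ‖f y‖) := by
    rw [potentialMul_eq_sum]
    calc _ ≤ ∑ j : Fin 4, ∑ k : Fin 4, C * (√2 ^ ρ * (1 + ‖y‖) ^ (-ρ)) * ‖f y‖ := by
          refine (norm_sum_le _ _).trans (Finset.sum_le_sum fun j _ =>
            (norm_sum_le _ _).trans (Finset.sum_le_sum fun k _ => ?_))
          rw [norm_smul, norm_mul, PiLp.norm_single, norm_one, mul_one]
          gcongr
          · exact (hQd y j k).trans (by gcongr)
          · exact PiLp.norm_apply_le (f y) k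
      _ = _ := by simp; ring
  rw [← ofReal_norm, ← ofReal_norm, decayWeight, ← ENNReal.ofReal_mul (by positivity),
    ENNReal.ofNNReal_toNNReal, ← ENNReal.ofReal_mul (by positivity)]
  exact ENNReal.ofReal_le_ofReal hnorm

lemma lintegral_enorm_sq_lt_top {f : R3 → Spinor} (hf : MemLp f 2) : ∫⁻ x, ‖f x‖ₑ ^ 2 < ∞ := by
  have := lintegral_rpow_enorm_lt_top_of_eLpNorm_lt_top two_ne_zero ENNReal.ofNat_ne_top hf.2
  simpa using this

/-- The potential term of a zero mode decays like `(1 + |y|) ^ (-3 - δ)` for some `δ > 0`, and the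
zero mode is given by its potential. -/
lemma IsZeroMode.exists_decay {Q : R3 → Matrix (Fin 4) (Fin 4) ℂ} (hQ : IsAdmissiblePotential Q)
    {f : R3 → Spinor} (hf : IsZeroMode Q f) :
    AEStronglyMeasurable (potentialMul Q f) ∧
    (∃ δ : ℝ, 0 < δ ∧ ∃ C : ℝ≥0, ∀ᵐ y, ‖potentialMul Q f y‖ₑ ≤ C * decayWeight (3 + δ) y) ∧
    ∀ᵐ x, (4 * Real.pi) • f x = Complex.I • diracPotential (potentialMul Q f) x := by
  obtain ⟨df, hs, hd⟩ := hf
  obtain ⟨ρ, hρ, K, hK⟩ := hQ.exists_enorm_potentialMul_le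
  have hF := aestronglyMeasurable_potentialMul hQ.aemeasurable hs.memLp.1
  have hu : AEMeasurable fun x => ‖f x‖ₑ := hs.memLp.1.enorm
  have h2 := lintegral_enorm_sq_lt_top hs.memLp
  have hle (x : R3) : ∫⁻ y, rieszKernel 2 x y * ‖potentialMul Q f y‖ₑ ≤
      K * ∫⁻ y, rieszKernel 2 x y * (decayWeight ρ y * ‖f y‖ₑ) := by
    rw [← lintegral_const_mul' _ _ ENNReal.coe_ne_top]
    refine lintegral_mono fun y => ?_
    simp only
    rw [mul_left_comm]
    gcongr
    exact hK f y
  have hfin : ∀ᵐ x, ∫⁻ y, rieszKernel 2 x y * ‖potentialMul Q f y‖ₑ < ∞ := by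
    filter_upwards [lintegral_rieszKernel_two_lt_top hρ hu h2] with x hx
    exact (hle x).trans_lt (ENNReal.mul_lt_top ENNReal.coe_lt_top hx)
  have hrep := ae_eq_integral_diracKernel hs hd hF hfin
  have hself : ∀ᵐ x, ‖f x‖ₑ ≤
      K * ∫⁻ y, rieszKernel 2 x y * (decayWeight ρ y * ‖f y‖ₑ) := by
    filter_upwards [hrep] with x hx
    have h1 : ‖f x‖ₑ ≤ ‖(4 * Real.pi) • f x‖ₑ := by
      rw [enorm_smul]
      refine le_mul_of_one_le_left' ?_
      rw [← ofReal_norm, ENNReal.one_le_ofReal, Real.norm_of_nonneg (by positivity)]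
      linarith [Real.pi_gt_three]
    refine h1.trans ?_
    have hI : ‖Complex.I‖ₑ = 1 := by rw [← ofReal_norm]; simp
    rw [hx, enorm_smul, hI, one_mul]
    refine (enorm_integral_le_lintegral_enorm _).trans ?_
    simpa only [enorm_diracKernel] using hle x
  obtain ⟨C, hC⟩ := exists_ae_le_decayWeight_two hρ hu h2 hself
  -- The potential contributes `ρ` and the zero mode `2`: in total `3 + (ρ - 1)`.
  refine ⟨hF, ⟨ρ - 1, by linarith, K * C, ?_⟩, hrep⟩
  filter_upwards [hC] with y hy
  calc ‖potentialMul Q f y‖ₑ ≤ K * (decayWeight ρ y * (C * decayWeight 2 y)) :=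
        (hK f y).trans (by gcongr)
    _ = (K * C : ℝ≥0) * (decayWeight ρ y * decayWeight 2 y) := by push_cast; ring
    _ = _ := by rw [decayWeight_mul_decayWeight, show ρ + 2 = 3 + (ρ - 1) by ring]

end DiracZeroMode

theorem mainTheorem2
    (Q : DiracZeroMode.R3 → Matrix (Fin 4) (Fin 4) ℂ)
    (hQ : DiracZeroMode.IsAdmissiblePotential Q)
    (f : DiracZeroMode.R3 → DiracZeroMode.Spinor)
    (hf : DiracZeroMode.IsZeroMode Q f) :
    Integrable (DiracZeroMode.potentialMul Q f) volume ∧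
    -- `g` is the continuous representative of the zero mode; it is unique
    ∃ g : DiracZeroMode.R3 → DiracZeroMode.Spinor, Continuous g ∧ f =ᵐ[volume] g ∧
      (∀ ω ∈ Metric.sphere (0 : DiracZeroMode.R3) 1,
        Tendsto (fun r : ℝ => r ^ 2 * ‖g (r • ω)‖) atTop
          (𝓝 (1 / (4 * Real.pi) * ‖∫ y, DiracZeroMode.potentialMul Q f y‖))) ∧
      ((∃ ω ∈ Metric.sphere (0 : DiracZeroMode.R3) 1,
          Tendsto (fun r : ℝ => r ^ 2 • g (r • ω)) atTop (𝓝 0)) ↔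
        ∫ y, DiracZeroMode.potentialMul Q f y = 0) ∧
      ((∀ ω ∈ Metric.sphere (0 : DiracZeroMode.R3) 1,
          Tendsto (fun r : ℝ => r ^ 2 • g (r • ω)) atTop (𝓝 0)) ↔
        ∫ y, DiracZeroMode.potentialMul Q f y = 0) := by
  obtain ⟨hF, ⟨δ, hδ, C, hC⟩, hrep⟩ := hf.exists_decay hQ
  set F := DiracZeroMode.potentialMul Q f with hFdef
  have hpi := Real.pi_pos
  set g : DiracZeroMode.R3 → DiracZeroMode.Spinor :=
    fun x => (4 * Real.pi)⁻¹ • Complex.I • DiracZeroMode.diracPotential F x with hg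
  have hlim : ∀ ω ∈ Metric.sphere (0 : DiracZeroMode.R3) 1,
      Tendsto (fun r : ℝ => r ^ 2 * ‖g (r • ω)‖) atTop (𝓝 (1 / (4 * Real.pi) * ‖∫ y, F y‖)) := by
    intro ω hω
    have hω' : ‖ω‖ = 1 := by simpa using hω
    have h1 := ((DiracZeroMode.tendsto_sq_smul_diracPotential hF hδ hC hω').norm).const_mul
      (1 / (4 * Real.pi))
    rw [norm_neg, DiracZeroMode.norm_alphaDot, hω', one_mul] at h1
    refine h1.congr fun r => ?_
    rw [hg, norm_smul, norm_smul, norm_smul, Complex.norm_I, one_mul,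
      Real.norm_of_nonneg (by positivity), Real.norm_of_nonneg (by positivity), one_div]
    ring
  -- Each single direction already detects `∫ F`, by uniqueness of the limit of norms; the
  -- quantifier over `ω` is then immaterial.
  have hzero : ∀ ω ∈ Metric.sphere (0 : DiracZeroMode.R3) 1,
      (Tendsto (fun r : ℝ => r ^ 2 • g (r • ω)) atTop (𝓝 0) ↔ ∫ y, F y = 0) := by
    intro ω hω
    have hn (r : ℝ) : ‖r ^ 2 • g (r • ω)‖ = r ^ 2 * ‖g (r • ω)‖ := by
      rw [norm_smul, Real.norm_of_nonneg (by positivity)]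
    rw [tendsto_zero_iff_norm_tendsto_zero]
    simp only [hn]
    constructor
    · intro h
      have h0 := tendsto_nhds_unique (hlim ω hω) h
      exact norm_eq_zero.1 ((mul_eq_zero.1 h0).resolve_left (by positivity))
    · intro h
      simpa [h] using hlim ω hω
  obtain ⟨ω₀, hω₀⟩ : (Metric.sphere (0 : DiracZeroMode.R3) 1).Nonempty :=
    NormedSpace.sphere_nonempty.2 zero_le_one
  refine ⟨DiracZeroMode.integrable_of_enorm_le_decayWeight hF hδ hC, g, ?_, ?_, hlim,
    ⟨fun ⟨ω, hω, h⟩ => (hzero ω hω).1 h, fun h => ⟨ω₀, hω₀, (hzero ω₀ hω₀).2 h⟩⟩,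
    ⟨fun h => (hzero ω₀ hω₀).1 (h ω₀ hω₀), fun h ω hω => (hzero ω hω).2 h⟩⟩
  · exact ((DiracZeroMode.continuous_diracPotential hF hδ hC).const_smul Complex.I).const_smul
      (4 * Real.pi)⁻¹
  · filter_upwards [hrep] with x hx
    rw [hg]
    simp only
    rw [← hx, smul_smul, inv_mul_cancel₀ (by positivity), one_smul]
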